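/- Let $\mathbb K=\mathbb R$ or $\mathbb C$ and $d=\dim_{\mathbb R}\mathbb K$. Let $\mathcal D_{n,\mathbb K}$ be the set of positive definite self-adjoint $n\times n$ matrices of trace $1$ over $\mathbb K$. Write $4\times4$ states in $2\times 2$ blocks, $\rho(D_1,D_2,C)=\begin{pmatrix}D_1&C\\C^*&D_2\end{pmatrix}$, put $T(\rho(D_1,D_2,C))=\rho(D_1,D_2,C^*)$, let $\mathcal D^s_{4,\mathbb K}=T(\mathcal D_{4,\mathbb K})\cap\mathcal D_{4,\mathbb K}$ be the set of separable states, and for $D\in\mathcal D_{2,\mathbb K}$ let $\mathcal D^s_{4,\mathbb K}(D)=\{\rho(D_1,D_2,C)\in\mathcal D^s_{4,\mathbb K}: D_1+D_2=D\}$. Throughout, $\lambda$ denotes Lebesgue measure in the (real components of the) independent matrix entries, i.e. for self-adjoint matrices the diagonal entries and the entries above the diagonal; on matrices of trace one the last diagonal entry is dropped. Endow $\mathcal D_{4,\mathbb K}$ with the monotone metric of $f(x)=\sqrt x$, $$g_f(\rho)(X,Y)=\operatorname{Tr}\Bigl(X\bigl(R_\rho^{1/2}f(L_\rho R_\rho^{-1})R_\rho^{1/2}\bigr)^{-1}(Y)\Bigr),\qquad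 L_\rho(X)=\rho X,\quad R_\rho(X)=X\rho .$$ Let $\sqrt{\det g_f}$ be its volume density in the entry coordinates. For a set $S\subseteq\mathcal D^s_{4,\mathbb K}$ put $\operatorname{Vol}_{\sqrt x}(S)=\int_S\sqrt{\det g_f}\,d\lambda$, and let the conditioned volume be $$\operatorname{Vol}_{\sqrt x}(S\mid D)=\int_{\{(D_1,C)\,:\,\rho(D_1,D-D_1,C)\in S\}}\sqrt{\det g_f}\;d\lambda(D_1)\,d\lambda(C).$$ For $0<r\le 1$ and $\varepsilon>0$ let $V_\varepsilon=\operatorname{diag}(1,\varepsilon)$, $$\eta_{d,r}(\varepsilon)=\int_{\{X\in\mathbb K^{2\times2}:\ \|X\|<r,\ \|V_\varepsilon^{-1}XV_\varepsilon\|<1\}}\det(I-XX^*)^{-\frac{3d}{4}-\frac12}\,d\lambda(X),\qquad \eta_d=\eta_{d,1},$$ with $\|\cdot\|$ the operator norm, and let $\mathcal D^{s,r}_{4,\mathbb K}=\{\rho(D_1,D_2,C)\in\mathcal D^s_{4,\mathbb K}:\|D_1^{-1/2}CD_2^{-1/2}\|<r\}$. Let $\mathcal E_{2,\mathbb K}$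 be the set of self-adjoint $2\times 2$ matrices $Y$ with $-I<Y<I$, and let $\sigma(A)=\sigma_2/\sigma_1$ be the ratio of the smaller to the larger singular value of $A$. Theorem. The following hold as identities in $[0,\infty]$. (1) For every $D\in\mathcal D_{2,\mathbb K}$, $$\operatorname{Vol}_{\sqrt x}(\mathcal D^s_{4,\mathbb K}\mid D)=4\det(D)^{\frac52d-\frac{d^2}{2}-1}\int_{\mathcal E_{2,\mathbb K}}\det(I-Y^2)^{\frac{d-2}{4}}\,\eta_d\Bigl(\sigma\Bigl(\sqrt{\tfrac{I-Y}{I+Y}}\Bigr)\Bigr)d\lambda(Y),$$ and $$\operatorname{Vol}_{\sqrt x}(\mathcal D^s_{4,\mathbb K})=\int_{\mathcal D_{2,\mathbb K}}\operatorname{Vol}_{\sqrt x}(\mathcal D^s_{4,\mathbb K}\mid D)\,d\lambda(D).$$ (2) Since these integrals diverge, the formula in (1) is only formal. Its precise content is the following exhaustion by the sets $\mathcal D^{s,r}_{4,\mathbb K}$, $r<1$. For every $0<r\le1$ and every $D\in\mathcal D_{2,\mathbb K}$, $$\operatorname{Vol}_{\sqrt x}(\mathcal D^{s,r}_{4,\mathbb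 K}\mid D)=2^d\det(D)^{\frac52d-\frac{d^2}{2}-1}\int_{\mathcal E_{2,\mathbb K}}\det(I-Y^2)^{\frac{d-2}{4}}\,\eta_{d,r}\Bigl(\sigma\Bigl(\sqrt{\tfrac{I-Y}{I+Y}}\Bigr)\Bigr)d\lambda(Y),$$ and $$\operatorname{Vol}_{\sqrt x}(\mathcal D^{s,r}_{4,\mathbb K})=\int_{\mathcal D_{2,\mathbb K}}\operatorname{Vol}_{\sqrt x}(\mathcal D^{s,r}_{4,\mathbb K}\mid D)\,d\lambda(D).$$ (For $r=1$ one recovers $\mathcal D^s_{4,\mathbb K}$, and $2^d=4$ for $d=2$.) -/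

import Mathlib

open MeasureTheory
open scoped Matrix Kronecker ENNReal ComplexOrder

noncomputable section

namespace QState

variable {𝕜 : Type*} [RCLike 𝕜]

/-! ### Monotone metrics and their volume form -/

section Metric

variable {n : Type*} [Fintype n] [DecidableEq n]

/-- The space of faithful states: positive definite self-adjoint matrices of trace one. -/
def densityMatrices (n 𝕜 : Type*) [Fintype n] [RCLike 𝕜] : Set (Matrix n n 𝕜) :=
  {D | D.PosDef ∧ D.trace = 1}

/-- Matrix of the superoperator `X ↦ D * X` acting on vectorized matrices. -/
def leftMul (D : Matrix n n 𝕜) : Matrix (n × n) (n × n) 𝕜 := (1 : Matrix n n 𝕜) ⊗ₖ D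

/-- Matrix of the superoperator `X ↦ X * D` acting on vectorized matrices. -/
def rightMul (D : Matrix n n 𝕜) : Matrix (n × n) (n × n) 𝕜 := Dᵀ ⊗ₖ (1 : Matrix n n 𝕜)

theorem leftMul_mulVec_vec (D X : Matrix n n 𝕜) :
    leftMul D *ᵥ X.vec = (D * X).vec := by
  simp [leftMul, Matrix.kronecker_mulVec_vec]

theorem rightMul_mulVec_vec (D X : Matrix n n 𝕜) :
    rightMul D *ᵥ X.vec = (X * D).vec := by
  simp [rightMul, Matrix.kronecker_mulVec_vec]

/-- The superoperator `R_D^{1/2} f(L_D R_D⁻¹) R_D^{1/2}`, by functional calculus. -/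
def metricKernel (f : ℝ → ℝ) (D : Matrix n n 𝕜) : Matrix (n × n) (n × n) 𝕜 :=
  cfc Real.sqrt (rightMul D) * cfc f (leftMul D * (rightMul D)⁻¹) * cfc Real.sqrt (rightMul D)

/-- The monotone metric `g_f(D)(X, Y) = Tr (X (R_D^{1/2} f(L_D R_D⁻¹) R_D^{1/2})⁻¹ (Y))`. -/
def monotoneMetric (f : ℝ → ℝ) (D X Y : Matrix n n 𝕜) : ℝ :=
  RCLike.re (X * Matrix.of fun i j => ((metricKernel f D)⁻¹ *ᵥ Y.vec) (j, i)).trace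

end Metric

/-- Index set of the real entry coordinates of a density matrix of size `m + 1`: the first `m`
diagonal entries and the real components of the entries above the diagonal. -/
abbrev CoordIdx (m : ℕ) (𝕜 : Type*) [RCLike 𝕜] : Type :=
  Fin m ⊕ ({p : Fin (m + 1) × Fin (m + 1) // p.1 < p.2} × Fin (Module.finrank ℝ 𝕜))

/-- The coordinate vector fields of these coordinates (traceless self-adjoint matrices); the
components of an entry are taken in an orthonormal basis of `𝕜` over `ℝ`. -/
def coordVec (m : ℕ) (𝕜 : Type*) [RCLike 𝕜] :
    CoordIdx m 𝕜 → Matrix (Fin (m + 1)) (Fin (m + 1)) 𝕜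
  | Sum.inl i => Matrix.single i.castSucc i.castSucc 1 - Matrix.single (Fin.last m) (Fin.last m) 1
  | Sum.inr (p, k) =>
      Matrix.single p.1.1 p.1.2 (stdOrthonormalBasis ℝ 𝕜 k) +
        Matrix.single p.1.2 p.1.1 (star (stdOrthonormalBasis ℝ 𝕜 k))

/-- The Riemannian volume density `√(det g_f(D))` in the entry coordinates. -/
def volumeDensity (f : ℝ → ℝ) {m : ℕ} (D : Matrix (Fin (m + 1)) (Fin (m + 1)) 𝕜) : ℝ :=
  √(Matrix.det (Matrix.of fun i j : CoordIdx m 𝕜 =>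
      monotoneMetric f D (coordVec m 𝕜 i) (coordVec m 𝕜 j)))

/-! ### Bipartite states of size four -/

/-- The self-adjoint matrix with diagonal entries `a`, `c` and upper right entry `b`. -/
def herm (a c : ℝ) (b : 𝕜) : Matrix (Fin 2) (Fin 2) 𝕜 := !![(a : 𝕜), b; star b, (c : 𝕜)]

abbrev BlockMatrix (𝕜 : Type*) : Type _ := Matrix (Fin 2 ⊕ Fin 2) (Fin 2 ⊕ Fin 2) 𝕜

/-- `ρ(D₁, D₂, C)`. -/
def blockState (D₁ D₂ C : Matrix (Fin 2) (Fin 2) 𝕜) : BlockMatrix 𝕜 :=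
  Matrix.fromBlocks D₁ C Cᴴ D₂

/-- The partial trace `ρ(D₁, D₂, C) ↦ D₁ + D₂`. -/
def partialTrace (ρ : BlockMatrix 𝕜) : Matrix (Fin 2) (Fin 2) 𝕜 := ρ.toBlocks₁₁ + ρ.toBlocks₂₂

/-- The involution `ρ(D₁, D₂, C) ↦ ρ(D₁, D₂, Cᴴ)`. -/
def involution (ρ : BlockMatrix 𝕜) : BlockMatrix 𝕜 :=
  blockState ρ.toBlocks₁₁ ρ.toBlocks₂₂ ρ.toBlocks₁₂ᴴ

/-- The separable faithful states: the states that stay states under the involution. -/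
def separableStates (𝕜 : Type*) [RCLike 𝕜] : Set (BlockMatrix 𝕜) :=
  involution '' densityMatrices (Fin 2 ⊕ Fin 2) 𝕜 ∩ densityMatrices (Fin 2 ⊕ Fin 2) 𝕜

/-- The elements of `S` with reduced state `D`. -/
def conditioned (S : Set (BlockMatrix 𝕜)) (D : Matrix (Fin 2) (Fin 2) 𝕜) : Set (BlockMatrix 𝕜) :=
  {ρ ∈ S | partialTrace ρ = D}

/-- The density `√(det g_f)` at a bipartite state. -/
def stateDensity (f : ℝ → ℝ) (ρ : BlockMatrix 𝕜) : ℝ :=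
  volumeDensity (m := 3) f 
    (Matrix.reindex (finSumFinEquiv (m := 2) (n := 2)) (finSumFinEquiv (m := 2) (n := 2)) ρ)

/-- The operator norm. -/
def opNorm (X : Matrix (Fin 2) (Fin 2) 𝕜) : ℝ := ‖Matrix.toEuclideanCLM (𝕜 := 𝕜) X‖

/-- `D^{-1/2}`. -/
def invSqrt (D : Matrix (Fin 2) (Fin 2) 𝕜) : Matrix (Fin 2) (Fin 2) 𝕜 :=
  cfc (fun x : ℝ => (√x)⁻¹) D

/-- The separable states `ρ(D₁, D₂, C)` with `‖D₁^{-1/2} C D₂^{-1/2}‖ < r`. -/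
def separableStatesBelow (𝕜 : Type*) [RCLike 𝕜] (r : ℝ) : Set (BlockMatrix 𝕜) :=
  {ρ ∈ separableStates 𝕜 |
    opNorm (invSqrt ρ.toBlocks₁₁ * ρ.toBlocks₁₂ * invSqrt ρ.toBlocks₂₂) < r}

/-! ### The function `η` -/

/-- The ratio `σ₂ / σ₁` of the smaller to the larger singular value. -/
def singularValueRatio (A : Matrix (Fin 2) (Fin 2) 𝕜) : ℝ :=
  A.toEuclideanLin.singularValues 1 / A.toEuclideanLin.singularValues 0

/-- The integral of `det (I - X Xᴴ) ^ (-3d/4 - 1/2)` over the matrices `X` with `‖X‖ < r` and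
`‖V⁻¹ X V‖ < 1`, where `V = diag(1, ε)` and `d = dim_ℝ 𝕜`. -/
def etaBelow (𝕜 : Type*) [RCLike 𝕜] [MeasurableSpace 𝕜] [BorelSpace 𝕜] (r ε : ℝ) : ℝ≥0∞ :=
  ∫⁻ X : Fin 2 → Fin 2 → 𝕜 in
      {X | opNorm (Matrix.of X) < r ∧
        opNorm ((Matrix.diagonal ![1, (ε : 𝕜)])⁻¹ * Matrix.of X * Matrix.diagonal ![1, (ε : 𝕜)]) < 1},
    ENNReal.ofReal ((RCLike.re (1 - Matrix.of X * (Matrix.of X)ᴴ).det) ^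
      (-(3 * (Module.finrank ℝ 𝕜 : ℝ) / 4) - 1 / 2))

/-- The function `η_d`: the integral over the whole open unit ball. -/
def eta (𝕜 : Type*) [RCLike 𝕜] [MeasurableSpace 𝕜] [BorelSpace 𝕜] (ε : ℝ) : ℝ≥0∞ :=
  etaBelow 𝕜 1 ε

/-- For a weight `h`, the integral of `det (I - Y²) ^ ((d - 2)/4) * h (σ(√((I - Y)/(I + Y))))`
over the operator interval `-I < Y < I` of self-adjoint matrices. -/
def operatorIntervalIntegral (𝕜 : Type*) [RCLike 𝕜] [MeasurableSpace 𝕜] [BorelSpace 𝕜]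
    (h : ℝ → ℝ≥0∞) : ℝ≥0∞ :=
  ∫⁻ y : ℝ × ℝ × 𝕜 in
      {y | (1 - herm y.1 y.2.1 y.2.2).PosDef ∧ (1 + herm y.1 y.2.1 y.2.2).PosDef},
    ENNReal.ofReal ((RCLike.re (1 - herm y.1 y.2.1 y.2.2 ^ 2).det) ^
      (((Module.finrank ℝ 𝕜 : ℝ) - 2) / 4)) *
    h (singularValueRatio (cfc (fun x : ℝ => √((1 - x) / (1 + x))) (herm y.1 y.2.1 y.2.2)))

/-! ### Volumes -/

/-- The volume of a set of states: the integral of `√(det g_f)` in the entry coordinates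
`(a₁, c₁, b₁)` of `D₁`, `(a₂, b₂)` of `D₂` and `C`; the last diagonal entry is determined by the
trace. -/
def stateVolume [MeasurableSpace 𝕜] [BorelSpace 𝕜] (f : ℝ → ℝ) (S : Set (BlockMatrix 𝕜)) : ℝ≥0∞ :=
  let ρ : (ℝ × ℝ × 𝕜) × (ℝ × 𝕜) × (Fin 2 → Fin 2 → 𝕜) → BlockMatrix 𝕜 := fun x =>
    blockState (herm x.1.1 x.1.2.1 x.1.2.2)
      (herm x.2.1.1 (1 - x.1.1 - x.1.2.1 - x.2.1.1) x.2.1.2) (Matrix.of x.2.2)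
  ∫⁻ x in {x | ρ x ∈ S}, ENNReal.ofReal (stateDensity f (ρ x))

/-- The conditioned volume: the integral of `√(det g_f)` over the states of `S` with reduced state
`D`, in the entry coordinates of `D₁` and `C` (so `D₂ = D - D₁`). -/
def conditionedVolume [MeasurableSpace 𝕜] [BorelSpace 𝕜] (f : ℝ → ℝ) (S : Set (BlockMatrix 𝕜))
    (D : Matrix (Fin 2) (Fin 2) 𝕜) : ℝ≥0∞ :=
  let ρ : (ℝ × ℝ × 𝕜) × (Fin 2 → Fin 2 → 𝕜) → BlockMatrix 𝕜 := fun x =>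
    blockState (herm x.1.1 x.1.2.1 x.1.2.2) (D - herm x.1.1 x.1.2.1 x.1.2.2) (Matrix.of x.2)
  ∫⁻ x in {x | ρ x ∈ conditioned S D}, ENNReal.ofReal (stateDensity f (ρ x))

/-- The integral of `h` over the one-system states of size two, in entry coordinates. -/
def baseIntegral [MeasurableSpace 𝕜] [BorelSpace 𝕜]
    (h : Matrix (Fin 2) (Fin 2) 𝕜 → ℝ≥0∞) : ℝ≥0∞ :=
  ∫⁻ z : ℝ × 𝕜 in {z | herm z.1 (1 - z.1) z.2 ∈ densityMatrices (Fin 2) 𝕜},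
    h (herm z.1 (1 - z.1) z.2)

end QState

end

/-! For $f=\sqrt{x}$ the superoperator of the metric at $\rho=Q^2$ is $X\mapsto QXQ$, so
$g(X,Y)=\operatorname{Re}\operatorname{Tr}(XQ^{-1}YQ^{-1})$. The state is $g$-orthogonal to all
traceless directions and has length one. Adding it to the coordinate frame therefore leaves the Gram
determinant unchanged and reduces it to the determinant of the congruence by $Q^{-1}$ on all
self-adjoint matrices. This gives the density $2^{3d}\det(\rho)^{-3d/4-1/2}$ (`volumeDensity_sqrt`).

Write $D_1=GG^*$, $D_2=HH^*$, $C=GXH^*$. Then $\rho>0$ means $\|X\|<1$, $\det\rho=\det D_1\det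
D_2\det(I-XX^*)$, and $X\mapsto C$ has Jacobian $(\det D_1\det D_2)^d$. If moreover
$H=lGV_\varepsilon$ with $l>0$, then $C^*=G(V_\varepsilon^{-1}XV_\varepsilon)^*H^*$, so positivity
of the partner state is exactly the second norm condition in $\eta$. Hence the integral over $C$ is
a power of $\det D_1\det D_2$ times $\eta_{d,r}(\varepsilon)$ (`lintegral_densityBelow_factorized`).

Such factors exist: with $D=S^2$ and $D_1=S\frac{I-Y}2S$, $D_2=S\frac{I+Y}2S$, diagonalizing $Y$
makes $G^{-1}H$ diagonal with entries $\sqrt{(1+\mu_i)/(1-\mu_i)}$, and $\varepsilon$ is their ratio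
(`lintegral_densityBelow_congr`). The Jacobian of $Y\mapsto D_1$ (`lintegral_herm_eq`) and the
bookkeeping of exponents (`jacobian_identity`) give the conditioned formula. The total volume
follows from the unimodular change $(D_1,D_2)\mapsto(D_1,D_1+D_2)$ and Tonelli.

The case $r=1$ has the constant $2^d$, which is not $4$ when $d=1$. The identity with $4$ holds
because both sides are infinite: $\eta_d(\varepsilon)=\infty$ for $0<\varepsilon\le1$
(`eta_eq_top`), since the integrand blows up at least like $(1-\|X\|^2)^{-1}$ on a cone of positive
measure. -/

noncomputable section

namespace QState

/-! ### Functional calculus and the metric of the square root. -/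

section SquareRoot

variable {n 𝕜 : Type*} [RCLike 𝕜] [Fintype n] [DecidableEq n]

theorem cfc_sqrt_eq_of_mul_self_eq {A B : Matrix n n 𝕜} (hB : B.PosSemidef) (h : B * B = A) :
    cfc Real.sqrt A = B := by
  have hs : IsSelfAdjoint B := hB.1
  have hspec : ∀ x ∈ spectrum ℝ B, 0 ≤ x := by
    intro x hx
    rw [hB.1.spectrum_real_eq_range_eigenvalues] at hx
    obtain ⟨i, rfl⟩ := hx
    exact hB.eigenvalues_nonneg i
  have hA : A = cfc (fun x : ℝ => x ^ 2) B := by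
    rw [cfc_pow_id B 2, pow_two, h]
  rw [hA, ← cfc_comp' Real.sqrt (fun x : ℝ => x ^ 2) B]
  conv_rhs => rw [← cfc_id ℝ B]
  exact cfc_congr fun x hx => Real.sqrt_sq (hspec x hx)

theorem cfc_sqrt_mul_self {A : Matrix n n 𝕜} (hA : A.PosSemidef) :
    cfc Real.sqrt A * cfc Real.sqrt A = A := by
  have hs : IsSelfAdjoint A := hA.1
  rw [← cfc_mul Real.sqrt Real.sqrt A]
  conv_rhs => rw [← cfc_id ℝ A]
  refine cfc_congr fun x hx => ?_
  rw [hA.1.spectrum_real_eq_range_eigenvalues] at hx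
  obtain ⟨i, rfl⟩ := hx
  exact Real.mul_self_sqrt (hA.eigenvalues_nonneg i)

theorem cfc_posDef {A : Matrix n n 𝕜} (hA : A.PosDef) {f : ℝ → ℝ} (hf : ∀ x, 0 < x → 0 < f x) :
    (cfc f A).PosDef := by
  have hdiag : (Matrix.diagonal (RCLike.ofReal ∘ f ∘ hA.1.eigenvalues) : Matrix n n 𝕜).PosDef := by
    rw [Matrix.posDef_diagonal_iff]
    intro i
    simpa using hf _ (hA.eigenvalues_pos i)
  rw [hA.1.cfc_eq, Matrix.IsHermitian.cfc, Unitary.conjStarAlgAut_apply]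
  exact (Matrix.IsUnit.posDef_star_right_conjugate_iff Unitary.isUnit_coe).2 hdiag

theorem exists_posDef_mul_self_eq {A : Matrix n n 𝕜} (hA : A.PosDef) :
    ∃ Q : Matrix n n 𝕜, Q.PosDef ∧ Q * Q = A :=
  ⟨cfc Real.sqrt A, cfc_posDef hA fun _ => Real.sqrt_pos.2, cfc_sqrt_mul_self hA.posSemidef⟩

/-- Left and right multiplications commute, so the roots can be taken factor by factor:
$R_{Q^2}^{1/2}=R_Q$ and $(L_{Q^2}R_{Q^2}^{-1})^{1/2}=L_QR_Q^{-1}$ up to vectorization. The product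
of the three factors is $X\mapsto QXQ$. Both roots are certified by uniqueness of the positive
square root. -/
theorem metricKernel_sqrt {Q : Matrix n n 𝕜} (hQ : Q.PosDef) :
    metricKernel Real.sqrt (Q * Q) = Qᵀ ⊗ₖ Q := by
  have hu : IsUnit Qᵀ.det := by
    rw [Matrix.det_transpose]; exact (Matrix.isUnit_iff_isUnit_det _).1 hQ.isUnit
  have h1 : cfc Real.sqrt (rightMul (Q * Q)) = Qᵀ ⊗ₖ (1 : Matrix n n 𝕜) := by
    apply cfc_sqrt_eq_of_mul_self_eq
    · exact (hQ.transpose.kronecker Matrix.PosDef.one).posSemidef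
    · rw [rightMul, ← Matrix.mul_kronecker_mul, Matrix.transpose_mul, one_mul]
  have h2 : cfc Real.sqrt (leftMul (Q * Q) * (rightMul (Q * Q))⁻¹) = (Qᵀ)⁻¹ ⊗ₖ Q := by
    apply cfc_sqrt_eq_of_mul_self_eq
    · exact (hQ.transpose.inv.kronecker hQ).posSemidef
    · rw [rightMul, leftMul, Matrix.inv_kronecker, ← Matrix.mul_kronecker_mul,
        ← Matrix.mul_kronecker_mul, Matrix.transpose_mul, Matrix.mul_inv_rev]
      simp
  rw [metricKernel, h1, h2, ← Matrix.mul_kronecker_mul, ← Matrix.mul_kronecker_mul,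
    Matrix.mul_nonsing_inv _ hu]
  simp

theorem monotoneMetric_sqrt {Q : Matrix n n 𝕜} (hQ : Q.PosDef) (X Y : Matrix n n 𝕜) :
    monotoneMetric Real.sqrt (Q * Q) X Y = RCLike.re (X * (Q⁻¹ * Y * Q⁻¹)).trace := by
  rw [monotoneMetric, metricKernel_sqrt hQ, Matrix.inv_kronecker, Matrix.kronecker_mulVec_vec,
    ← Matrix.transpose_nonsing_inv, Matrix.transpose_transpose]
  rfl

end SquareRoot

/-! ### Real coordinates of self-adjoint matrices and the determinant of a congruence. -/

section Coordinates

variable {𝕜 : Type*} [RCLike 𝕜] {m : ℕ}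

/-- Index set of the real coordinates of all self-adjoint matrices of size `m + 1`. -/
abbrev FullIdx (m : ℕ) (𝕜 : Type*) [RCLike 𝕜] : Type := CoordIdx m 𝕜 ⊕ Unit

/-- The real basis of the self-adjoint matrices given by the matrix units. -/
def fullVec (m : ℕ) (𝕜 : Type*) [RCLike 𝕜] :
    FullIdx m 𝕜 → Matrix (Fin (m + 1)) (Fin (m + 1)) 𝕜
  | Sum.inl (Sum.inl i) => Matrix.single i.castSucc i.castSucc 1
  | Sum.inl (Sum.inr pk) => coordVec m 𝕜 (Sum.inr pk)
  | Sum.inr _ => Matrix.single (Fin.last m) (Fin.last m) 1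

/-- The coordinate functionals dual to `fullVec`. -/
def fullCoord : FullIdx m 𝕜 → Matrix (Fin (m + 1)) (Fin (m + 1)) 𝕜 →ₗ[ℝ] ℝ
  | Sum.inl (Sum.inl i) =>
    { toFun := fun X => RCLike.re (X i.castSucc i.castSucc)
      map_add' := by simp
      map_smul' := fun c X => by simp [RCLike.smul_re] }
  | Sum.inl (Sum.inr (p, k)) =>
    { toFun := fun X => (stdOrthonormalBasis ℝ 𝕜).repr (X p.1.1 p.1.2) k
      map_add' := by simp
      map_smul' := by simp }
  | Sum.inr _ =>
    { toFun := fun X => RCLike.re (X (Fin.last m) (Fin.last m))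
      map_add' := by simp
      map_smul' := fun c X => by simp [RCLike.smul_re] }

theorem fullVec_isHermitian (j : FullIdx m 𝕜) : (fullVec m 𝕜 j).IsHermitian := by
  rcases j with (i | ⟨p, k⟩) | u
  · simp [fullVec, Matrix.IsHermitian, Matrix.conjTranspose_single]
  · simp [fullVec, coordVec, Matrix.IsHermitian, Matrix.conjTranspose_single, add_comm]
  · simp [fullVec, Matrix.IsHermitian, Matrix.conjTranspose_single]

theorem eq_sum_diag_add_sum_offDiag {X : Matrix (Fin (m + 1)) (Fin (m + 1)) 𝕜}
    (hX : X.IsHermitian) :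
    X = ∑ i, Matrix.single i i (X i i) +
      ∑ p : {p : Fin (m + 1) × Fin (m + 1) // p.1 < p.2},
        (Matrix.single p.1.1 p.1.2 (X p.1.1 p.1.2) +
          Matrix.single p.1.2 p.1.1 (star (X p.1.1 p.1.2))) := by
  ext a b
  simp only [Matrix.add_apply, Matrix.sum_apply, Matrix.single_apply]
  rcases lt_trichotomy a b with h | rfl | h
  · rw [Finset.sum_eq_zero, zero_add, Finset.sum_eq_single ⟨(a, b), h⟩]
    · simp [h.ne, h.ne']
    · rintro ⟨⟨c, e⟩, hce⟩ - hne
      have h1 : ¬(c = a ∧ e = b) := fun hh => hne (by simp [hh.1, hh.2])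
      have h2 : ¬(e = a ∧ c = b) := by
        rintro ⟨rfl, rfl⟩
        exact lt_asymm h hce
      simp [h1, h2]
    · simp
    · intro i _
      rw [if_neg]
      rintro ⟨rfl, rfl⟩
      exact lt_irrefl _ h
  · rw [Finset.sum_eq_single a, Finset.sum_eq_zero, add_zero]
    · simp
    · rintro ⟨⟨c, e⟩, hce⟩ -
      have h1 : ¬(c = a ∧ e = a) := by
        rintro ⟨rfl, rfl⟩
        exact lt_irrefl _ hce
      have h2 : ¬(e = a ∧ c = a) := by
        rintro ⟨rfl, rfl⟩
        exact lt_irrefl _ hce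
      simp [h1, h2]
    · intro i _ hi
      simp [hi]
    · simp
  · rw [Finset.sum_eq_zero, zero_add, Finset.sum_eq_single ⟨(b, a), h⟩]
    · have : star (X b a) = X a b := hX.apply a b
      simpa [h.ne, h.ne'] using this.symm
    · rintro ⟨⟨c, e⟩, hce⟩ - hne
      have h1 : ¬(e = a ∧ c = b) := fun hh => hne (by simp [hh.1, hh.2])
      have h2 : ¬(c = a ∧ e = b) := by
        rintro ⟨rfl, rfl⟩
        exact lt_asymm h hce
      simp [h1, h2]
    · simp
    · intro i _
      rw [if_neg]
      rintro ⟨rfl, rfl⟩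
      exact lt_irrefl _ h

theorem sum_fullCoord_smul_fullVec {X : Matrix (Fin (m + 1)) (Fin (m + 1)) 𝕜}
    (hX : X.IsHermitian) : ∑ j, fullCoord j X • fullVec m 𝕜 j = X := by
  have hdiag : ∀ i, ((RCLike.re (X i i) : ℝ) : 𝕜) = X i i := fun i => by
    have := hX.coe_re_apply_self i
    exact this
  have hoff : ∀ z : 𝕜,
      ∑ k, (stdOrthonormalBasis ℝ 𝕜).repr z k • stdOrthonormalBasis ℝ 𝕜 k = z :=
    fun z => (stdOrthonormalBasis ℝ 𝕜).sum_repr z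
  have hoffs : ∀ z : 𝕜,
      ∑ k, (stdOrthonormalBasis ℝ 𝕜).repr z k • star (stdOrthonormalBasis ℝ 𝕜 k) = star z := by
    intro z
    conv_rhs => rw [← hoff z, star_sum]
    simp [RCLike.real_smul_eq_coe_mul]
  have hs : ∀ (a b : Fin (m + 1)) (c : ℝ) (z : 𝕜),
      c • Matrix.single a b z = Matrix.single a b (c • z) := fun a b c z => by
    rw [Matrix.smul_single]
  rw [Fintype.sum_sum_type, Fintype.sum_sum_type, Fintype.sum_prod_type]
  conv_rhs => rw [eq_sum_diag_add_sum_offDiag hX, Fin.sum_univ_castSucc]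
  have h1 : ∀ p : {p : Fin (m + 1) × Fin (m + 1) // p.1 < p.2},
      ∑ k, fullCoord (Sum.inl (Sum.inr (p, k))) X • fullVec m 𝕜 (Sum.inl (Sum.inr (p, k))) =
        Matrix.single p.1.1 p.1.2 (X p.1.1 p.1.2) +
          Matrix.single p.1.2 p.1.1 (star (X p.1.1 p.1.2)) := by
    intro p
    simp only [fullCoord, fullVec, coordVec, LinearMap.coe_mk, AddHom.coe_mk, smul_add, hs,
      Finset.sum_add_distrib]
    conv_rhs => rw [← hoff (X p.1.1 p.1.2)]
    rw [hoff]
    congr 1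
    · conv_rhs => rw [← hoff (X p.1.1 p.1.2)]
      exact (map_sum (Matrix.singleAddMonoidHom (α := 𝕜) p.1.1 p.1.2) _ _).symm
    · conv_rhs => rw [← hoffs (X p.1.1 p.1.2)]
      exact (map_sum (Matrix.singleAddMonoidHom (α := 𝕜) p.1.2 p.1.1) _ _).symm
  simp only [h1]
  simp only [fullCoord, fullVec, LinearMap.coe_mk, AddHom.coe_mk, hs, Finset.univ_unique,
    Finset.sum_singleton, RCLike.real_smul_eq_coe_mul, mul_one, hdiag]
  abel

theorem fullCoord_fullVec (i j : FullIdx m 𝕜) :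
    fullCoord i (fullVec m 𝕜 j) = (1 : Matrix (FullIdx m 𝕜) (FullIdx m 𝕜) ℝ) i j := by
  have hne : ∀ i : Fin m, Fin.last m ≠ i.castSucc := fun i => (Fin.castSucc_lt_last i).ne'
  rcases i with (i | ⟨⟨⟨a, b⟩, hab⟩, k⟩) | u <;> rcases j with (j | ⟨⟨⟨c, e⟩, hce⟩, l⟩) | v <;>
    simp only [fullCoord, fullVec, coordVec, LinearMap.coe_mk, AddHom.coe_mk, Matrix.add_apply,
      Matrix.single_apply, Matrix.one_apply]
  · by_cases h : i = j
    · simp [h]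
    · simp [h, Ne.symm h]
  · have h1 : ∀ i, ¬(c = i ∧ e = i) := by
      rintro i ⟨rfl, rfl⟩
      exact lt_irrefl _ hce
    have h2 : ∀ i, ¬(e = i ∧ c = i) := by
      rintro i ⟨rfl, rfl⟩
      exact lt_irrefl _ hce
    simp [h1, h2]
  · simp [hne]
  · rw [if_neg]
    · simp
    · rintro ⟨rfl, rfl⟩
      exact lt_irrefl _ hab
  · have h2 : ¬(e = a ∧ c = b) := by
      rintro ⟨rfl, rfl⟩
      exact lt_asymm hab hce
    by_cases h : c = a ∧ e = b
    · obtain ⟨rfl, rfl⟩ := h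
      have h3 : ¬(e = c ∧ c = e) := h2
      simp [h3]
    · have h3 : ¬(a = c ∧ b = e) := fun hh => h ⟨hh.1.symm, hh.2.symm⟩
      simp [h, h2, h3]
  · rw [if_neg]
    · simp
    · rintro ⟨h1, h2⟩
      exact hab.ne (h1.symm.trans h2)
  · simp [(hne _).symm]
  · have h1 : ∀ i, ¬(c = i ∧ e = i) := by
      rintro i ⟨rfl, rfl⟩
      exact lt_irrefl _ hce
    have h2 : ∀ i, ¬(e = i ∧ c = i) := by
      rintro i ⟨rfl, rfl⟩
      exact lt_irrefl _ hce
    simp [h1, h2]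
  · simp

/-- The basis is orthogonal for the trace form. Off-diagonal vectors have squared length 2 because
the entry and its conjugate both contribute. -/
theorem re_trace_fullVec_mul (i : FullIdx m 𝕜) {X : Matrix (Fin (m + 1)) (Fin (m + 1)) 𝕜}
    (hX : X.IsHermitian) :
    RCLike.re (fullVec m 𝕜 i * X).trace =
      Sum.elim (Sum.elim (fun _ => 1) (fun _ => 2)) (fun _ => 1) i * fullCoord i X := by
  rcases i with (i | ⟨p, k⟩) | u
  · simp [fullVec, fullCoord, Matrix.trace_single_mul]
  · simp only [fullVec, coordVec, fullCoord, LinearMap.coe_mk, AddHom.coe_mk, Sum.elim_inl,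
      Sum.elim_inr, Matrix.add_mul, Matrix.trace_add, Matrix.trace_single_mul,
      OrthonormalBasis.repr_apply_apply]
    have h1 : X p.1.2 p.1.1 = star (X p.1.1 p.1.2) := (hX.apply _ _).symm
    have h2 : ∀ a b : 𝕜, inner ℝ a b = RCLike.re (star a * b) := fun a b => by
      change RCLike.re (b * star a) = _
      rw [mul_comm]
    have h3 : ∀ a b : 𝕜, RCLike.re (a * star b + star a * b) = 2 * RCLike.re (star a * b) := by
      intro a b
      simp only [RCLike.star_def, map_add, RCLike.mul_re, RCLike.conj_re, RCLike.conj_im]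
      ring
    rw [h1, h2]
    exact h3 _ _
  · simp [fullVec, fullCoord, Matrix.trace_single_mul]

/-- The matrix of `X ↦ A X Aᴴ` on the self-adjoint matrices. -/
def congrMatrix (A : Matrix (Fin (m + 1)) (Fin (m + 1)) 𝕜) :
    Matrix (FullIdx m 𝕜) (FullIdx m 𝕜) ℝ :=
  Matrix.of fun i j => fullCoord i (A * fullVec m 𝕜 j * Aᴴ)

theorem fullCoord_congr (A : Matrix (Fin (m + 1)) (Fin (m + 1)) 𝕜) (i : FullIdx m 𝕜)
    {X : Matrix (Fin (m + 1)) (Fin (m + 1)) 𝕜} (hX : X.IsHermitian) :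
    fullCoord i (A * X * Aᴴ) = ∑ j, congrMatrix A i j * fullCoord j X := by
  conv_lhs => rw [← sum_fullCoord_smul_fullVec hX]
  simp only [Finset.mul_sum, Finset.sum_mul, map_sum, Matrix.mul_smul, Matrix.smul_mul, map_smul,
    smul_eq_mul, congrMatrix, Matrix.of_apply]
  exact Finset.sum_congr rfl fun j _ => mul_comm _ _

theorem congrMatrix_mul (A B : Matrix (Fin (m + 1)) (Fin (m + 1)) 𝕜) :
    congrMatrix (A * B) = congrMatrix A * congrMatrix B := by
  ext i j
  rw [Matrix.mul_apply]
  have := fullCoord_congr A i (Matrix.isHermitian_mul_mul_conjTranspose B (fullVec_isHermitian j))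
  simpa [congrMatrix, Matrix.mul_assoc] using this

theorem congrMatrix_one : congrMatrix (1 : Matrix (Fin (m + 1)) (Fin (m + 1)) 𝕜) = 1 := by
  ext i j
  simpa [congrMatrix] using fullCoord_fullVec i j

/-- The eigenvalues of `congrMatrix` for a diagonal matrix. -/
def congrWeight (μ : Fin (m + 1) → ℝ) : FullIdx m 𝕜 → ℝ :=
  Sum.elim (Sum.elim (fun i => μ i.castSucc ^ 2) (fun pk => μ pk.1.1.1 * μ pk.1.1.2))
    (fun _ => μ (Fin.last m) ^ 2)

theorem congrMatrix_diagonal (μ : Fin (m + 1) → ℝ) :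
    congrMatrix (Matrix.diagonal (fun i => (μ i : 𝕜))) = Matrix.diagonal (congrWeight μ) := by
  ext i j
  have h : ∀ (X : Matrix (Fin (m + 1)) (Fin (m + 1)) 𝕜) a b,
      (Matrix.diagonal (fun i => (μ i : 𝕜)) * X * (Matrix.diagonal (fun i => (μ i : 𝕜)))ᴴ) a b =
        (μ a * μ b : ℝ) • X a b := by
    intro X a b
    rw [Matrix.diagonal_conjTranspose, Matrix.mul_diagonal, Matrix.diagonal_mul]
    simp [RCLike.real_smul_eq_coe_mul]
    ring
  have h' : ∀ X : Matrix (Fin (m + 1)) (Fin (m + 1)) 𝕜,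
      fullCoord i (Matrix.diagonal (fun i => (μ i : 𝕜)) * X *
        (Matrix.diagonal (fun i => (μ i : 𝕜)))ᴴ) = congrWeight μ i * fullCoord i X := by
    intro X
    rcases i with (i | ⟨p, k⟩) | u
    · simp [fullCoord, h, congrWeight, RCLike.smul_re, pow_two, -Matrix.diagonal_conjTranspose]
    · simp [fullCoord, h, congrWeight, -Matrix.diagonal_conjTranspose]
    · simp [fullCoord, h, congrWeight, RCLike.smul_re, pow_two, -Matrix.diagonal_conjTranspose]
  rw [congrMatrix, Matrix.of_apply, h', fullCoord_fullVec, Matrix.diagonal_apply, Matrix.one_apply]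
  simp

/-- Congruence is multiplicative in the matrix, so the determinants belonging to $U$ and $U^*$ are
inverse to each other and cancel. This reduces the Hermitian case to the diagonal one. -/
theorem det_congrMatrix_conj {A U : Matrix (Fin (m + 1)) (Fin (m + 1)) 𝕜} (hU : Uᴴ * U = 1) :
    (congrMatrix (U * A * Uᴴ)).det = (congrMatrix A).det := by
  have h : (congrMatrix Uᴴ).det * (congrMatrix U).det = 1 := by
    rw [← Matrix.det_mul, ← congrMatrix_mul, hU, congrMatrix_one, Matrix.det_one]
  rw [congrMatrix_mul, congrMatrix_mul, Matrix.det_mul, Matrix.det_mul]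
  linear_combination (congrMatrix A).det * h

/-- Each index lies in three of the six pairs, and each pair carries $d$ real coordinates, which
gives $3d$. The diagonal coordinates contribute the exponent 2. -/
theorem prod_congrWeight (μ : Fin 4 → ℝ) :
    ∏ i, congrWeight (m := 3) (𝕜 := 𝕜) μ i = (∏ i, μ i) ^ (2 + 3 * Module.finrank ℝ 𝕜) := by
  rw [Fintype.prod_sum_type, Fintype.prod_sum_type, Fintype.prod_prod_type]
  simp only [congrWeight, Sum.elim_inl, Sum.elim_inr, Finset.prod_const, Finset.card_univ,
    Fintype.card_fin, Finset.prod_pow]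
  have h : ∏ p : {p : Fin 4 × Fin 4 // p.1 < p.2}, (μ p.1.1 * μ p.1.2) = (∏ i, μ i) ^ 3 := by
    rw [← Finset.prod_subtype (Finset.univ.filter fun p : Fin 4 × Fin 4 => p.1 < p.2) (by simp)
      (fun p : Fin 4 × Fin 4 => μ p.1 * μ p.2), Finset.prod_filter, Fintype.prod_prod_type]
    simp [Fin.prod_univ_four]
    ring
  rw [h, pow_add, pow_mul, Fin.prod_univ_castSucc μ]
  simp
  ring

theorem det_congrMatrix_of_isHermitian {A : Matrix (Fin 4) (Fin 4) 𝕜} (hA : A.IsHermitian) :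
    (congrMatrix (m := 3) A).det = (RCLike.re A.det) ^ (2 + 3 * Module.finrank ℝ 𝕜) := by
  have hdet : RCLike.re A.det = ∏ i, hA.eigenvalues i := by
    rw [hA.det_eq_prod_eigenvalues, ← RCLike.ofReal_prod, RCLike.ofReal_re]
  have hU : (hA.eigenvectorUnitary : Matrix (Fin 4) (Fin 4) 𝕜)ᴴ *
      (hA.eigenvectorUnitary : Matrix (Fin 4) (Fin 4) 𝕜) = 1 :=
    Unitary.coe_star_mul_self _
  conv_lhs => rw [hA.spectral_theorem, Unitary.conjStarAlgAut_apply]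
  rw [hdet, ← prod_congrWeight (𝕜 := 𝕜) hA.eigenvalues, ← Matrix.det_diagonal,
    ← congrMatrix_diagonal]
  exact det_congrMatrix_conj hU

end Coordinates

/-! ### The volume density at a state of size four. -/

section Density

variable {𝕜 : Type*} [RCLike 𝕜] {m : ℕ}

theorem coordVec_eq (j : CoordIdx m 𝕜) :
    coordVec m 𝕜 j = fullVec m 𝕜 (Sum.inl j) -
      Sum.elim (fun _ => (1 : ℝ)) (fun _ => 0) j • fullVec m 𝕜 (Sum.inr ()) := by
  rcases j with i | pk <;> simp [coordVec, fullVec]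

theorem coordVec_isHermitian (j : CoordIdx m 𝕜) : (coordVec m 𝕜 j).IsHermitian := by
  rw [coordVec_eq]
  exact (fullVec_isHermitian _).sub (IsSelfAdjoint.smul (.all _) (fullVec_isHermitian _))

theorem trace_coordVec (j : CoordIdx m 𝕜) : (coordVec m 𝕜 j).trace = 0 := by
  rcases j with i | ⟨p, k⟩
  · simp [coordVec]
  · simp [coordVec, Matrix.trace_add, Matrix.trace_single_eq_of_ne _ _ _ p.2.ne,
      Matrix.trace_single_eq_of_ne _ _ _ p.2.ne']

/-- The coordinate vector fields, completed by the state itself. -/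
def framed (D : Matrix (Fin (m + 1)) (Fin (m + 1)) 𝕜) :
    FullIdx m 𝕜 → Matrix (Fin (m + 1)) (Fin (m + 1)) 𝕜 :=
  Sum.elim (coordVec m 𝕜) (fun _ => D)

theorem framed_isHermitian {D : Matrix (Fin (m + 1)) (Fin (m + 1)) 𝕜} (hD : D.IsHermitian)
    (j : FullIdx m 𝕜) : (framed D j).IsHermitian := by
  rcases j with j | u
  · exact coordVec_isHermitian j
  · exact hD

/-- The trace-one constraint subtracts the last diagonal unit from the other ones. Eliminating the
identity block leaves the sum of all diagonal entries of the state, that is, its trace. -/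
theorem det_fullCoord_framed {D : Matrix (Fin (m + 1)) (Fin (m + 1)) 𝕜} (hD : D.trace = 1) :
    (Matrix.of fun i j : FullIdx m 𝕜 => fullCoord i (framed D j)).det = 1 := by
  have h : (Matrix.of fun i j : FullIdx m 𝕜 => fullCoord i (framed D j)) =
      Matrix.fromBlocks 1 (Matrix.of fun i _ => fullCoord (Sum.inl i) D)
        (Matrix.of fun _ j => -Sum.elim (fun _ => (1 : ℝ)) (fun _ => 0) j)
        (Matrix.of fun _ _ => fullCoord (Sum.inr ()) D) := by
    ext i j
    rcases i with i | u <;> rcases j with j | v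
    · simp [framed, coordVec_eq, fullCoord_fullVec, Matrix.one_apply]
    · simp [framed]
    · simp [framed, coordVec_eq, fullCoord_fullVec]
    · simp [framed]
  have ht : RCLike.re D.trace = 1 := by rw [hD, RCLike.one_re]
  rw [Matrix.trace, map_sum, Fin.sum_univ_castSucc] at ht
  rw [h, Matrix.det_fromBlocks_one₁₁, Matrix.det_unique]
  simp only [Matrix.sub_apply, Matrix.of_apply, Matrix.mul_apply, Fintype.sum_sum_type]
  refine Eq.trans ?_ ht
  simp [fullCoord, add_comm]

/-- The squared lengths of the basis `fullVec` for the trace form. -/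
def fullWeight : FullIdx m 𝕜 → ℝ := Sum.elim (Sum.elim (fun _ => 1) (fun _ => 2)) (fun _ => 1)

/-- A Gram matrix in a new frame is $B^{T}MB$, where $B$ holds the frame in coordinates and $M$ is
the bilinear form in the old basis. -/
theorem re_trace_framed {D : Matrix (Fin (m + 1)) (Fin (m + 1)) 𝕜} (hD : D.IsHermitian)
    {P : Matrix (Fin (m + 1)) (Fin (m + 1)) 𝕜} (hP : P.IsHermitian) :
    (Matrix.of fun i j : FullIdx m 𝕜 => RCLike.re (framed D i * (P * framed D j * P)).trace) =
      (Matrix.of fun i j : FullIdx m 𝕜 => fullCoord i (framed D j))ᵀ *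
        (Matrix.diagonal fullWeight * congrMatrix P) *
          (Matrix.of fun i j : FullIdx m 𝕜 => fullCoord i (framed D j)) := by
  ext i j
  have hPj : (P * framed D j * Pᴴ).IsHermitian :=
    Matrix.isHermitian_mul_mul_conjTranspose P (framed_isHermitian hD j)
  rw [Matrix.mul_assoc, Matrix.mul_apply, Matrix.of_apply]
  conv_lhs => rw [← sum_fullCoord_smul_fullVec (framed_isHermitian hD i)]
  rw [Finset.sum_mul, Matrix.trace_sum, map_sum]
  refine Finset.sum_congr rfl fun k _ => ?_
  rw [Matrix.smul_mul, Matrix.trace_smul, RCLike.smul_re, Matrix.transpose_apply, Matrix.of_apply,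
    Matrix.mul_assoc (Matrix.diagonal _), Matrix.diagonal_mul, Matrix.mul_apply]
  congr 1
  have := re_trace_fullVec_mul k hPj
  rw [fullCoord_congr P k (framed_isHermitian hD j), hP.eq] at this
  exact this

theorem prod_fullWeight :
    ∏ i, fullWeight (m := 3) (𝕜 := 𝕜) i = 2 ^ (6 * Module.finrank ℝ 𝕜) := by
  have hc : Fintype.card {p : Fin 4 × Fin 4 // p.1 < p.2} = 6 := by decide
  rw [Fintype.prod_sum_type, Fintype.prod_sum_type]
  simp [fullWeight, hc]

theorem det_gram_sqrt {Q : Matrix (Fin 4) (Fin 4) 𝕜} (hQ : Q.PosDef) (ht : (Q * Q).trace = 1) :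
    (Matrix.of fun i j : CoordIdx 3 𝕜 =>
      monotoneMetric Real.sqrt (Q * Q) (coordVec 3 𝕜 i) (coordVec 3 𝕜 j)).det =
      2 ^ (6 * Module.finrank ℝ 𝕜) * (RCLike.re Q⁻¹.det) ^ (2 + 3 * Module.finrank ℝ 𝕜) := by
  have hu : IsUnit Q.det := (Matrix.isUnit_iff_isUnit_det _).1 hQ.isUnit
  have hD : (Q * Q).IsHermitian := by
    simpa [hQ.1.eq] using Matrix.isHermitian_mul_conjTranspose_self Q
  have hinv : Q⁻¹ * (Q * Q) * Q⁻¹ = 1 := by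
    rw [← Matrix.mul_assoc, Matrix.nonsing_inv_mul _ hu, Matrix.one_mul,
      Matrix.mul_nonsing_inv _ hu]
  -- Since $Q^{-1}Q^2Q^{-1}=I$, pairing any $X$ with the state gives $\operatorname{Tr}X$: zero on
  -- coordinate vectors and one on the state itself.
  have hblock : (Matrix.of fun i j : FullIdx 3 𝕜 =>
      RCLike.re (framed (Q * Q) i * (Q⁻¹ * framed (Q * Q) j * Q⁻¹)).trace) =
      Matrix.fromBlocks (Matrix.of fun i j : CoordIdx 3 𝕜 =>
        monotoneMetric Real.sqrt (Q * Q) (coordVec 3 𝕜 i) (coordVec 3 𝕜 j)) 0 0 1 := by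
    ext i j
    rcases i with i | u <;> rcases j with j | v
    · simp [framed, monotoneMetric_sqrt hQ]
    · simp [framed, hinv, trace_coordVec]
    · simp only [framed, Sum.elim_inl, Sum.elim_inr, Matrix.of_apply, Matrix.fromBlocks_apply₂₁,
        Matrix.zero_apply]
      have : (Q * Q * (Q⁻¹ * coordVec 3 𝕜 j * Q⁻¹)).trace = (coordVec 3 𝕜 j).trace := by
        rw [Matrix.trace_mul_comm, Matrix.mul_assoc _ Q⁻¹, ← Matrix.mul_assoc Q⁻¹ Q,
          Matrix.nonsing_inv_mul _ hu, Matrix.one_mul, Matrix.mul_assoc, Matrix.trace_mul_comm,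
          Matrix.mul_assoc, Matrix.mul_nonsing_inv _ hu, Matrix.mul_one]
      rw [this, trace_coordVec, map_zero]
    · simp [framed, hinv, ht]
  have h := congrArg Matrix.det hblock
  rw [re_trace_framed hD hQ.inv.1, Matrix.det_mul, Matrix.det_mul, Matrix.det_transpose,
    det_fullCoord_framed ht, Matrix.det_mul, Matrix.det_diagonal, prod_fullWeight,
    det_congrMatrix_of_isHermitian hQ.inv.1, Matrix.det_fromBlocks_zero₂₁, Matrix.det_one] at h
  simpa using h.symm

theorem volumeDensity_sqrt {D : Matrix (Fin 4) (Fin 4) 𝕜} (hD : D.PosDef) (ht : D.trace = 1) :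
    volumeDensity (m := 3) Real.sqrt D = 2 ^ (3 * Module.finrank ℝ 𝕜) *
      (RCLike.re D.det) ^ (-(3 * (Module.finrank ℝ 𝕜 : ℝ) / 4) - 1 / 2) := by
  obtain ⟨Q, hQ, rfl⟩ := exists_posDef_mul_self_eq hD
  obtain ⟨q, hq0, hq⟩ : ∃ q : ℝ, 0 < q ∧ Q.det = (q : 𝕜) := by
    have := hQ.det_pos
    rw [RCLike.pos_iff] at this
    exact ⟨RCLike.re Q.det, this.1, (RCLike.ext (by simp) (by simp [this.2]))⟩
  rw [volumeDensity, det_gram_sqrt hQ ht, Matrix.det_mul, Matrix.det_nonsing_inv, hq,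
    Ring.inverse_eq_inv', ← RCLike.ofReal_inv, ← RCLike.ofReal_mul, RCLike.ofReal_re,
    RCLike.ofReal_re]
  -- With $\det\rho=q^2$, the square of the claimed density has exponent
  -- $2\cdot2\,(-3d/4-1/2)=-(2+3d)$ in $q$, which is that of the Gram determinant.
  rw [Real.sqrt_eq_iff_mul_self_eq_of_pos (by positivity)]
  have h1 : (q * q) ^ (-(3 * (Module.finrank ℝ 𝕜 : ℝ) / 4) - 1 / 2) *
      (q * q) ^ (-(3 * (Module.finrank ℝ 𝕜 : ℝ) / 4) - 1 / 2) =
      q⁻¹ ^ (2 + 3 * Module.finrank ℝ 𝕜) := by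
    rw [← Real.rpow_add (by positivity), ← pow_two, ← Real.rpow_natCast q 2,
      ← Real.rpow_mul hq0.le, ← Real.rpow_natCast, Real.inv_rpow hq0.le, ← Real.rpow_neg hq0.le]
    congr 1
    push_cast
    ring
  rw [← h1]
  ring

theorem stateDensity_sqrt {ρ : BlockMatrix 𝕜} (hρ : ρ ∈ densityMatrices (Fin 2 ⊕ Fin 2) 𝕜) :
    stateDensity Real.sqrt ρ = 2 ^ (3 * Module.finrank ℝ 𝕜) *
      (RCLike.re ρ.det) ^ (-(3 * (Module.finrank ℝ 𝕜 : ℝ) / 4) - 1 / 2) := by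
  rw [stateDensity, volumeDensity_sqrt, Matrix.det_reindex_self]
  · rw [Matrix.reindex_apply]
    exact hρ.1.submatrix (Equiv.injective _)
  · rw [← hρ.2, Matrix.reindex_apply, Matrix.trace, Matrix.trace]
    exact Equiv.sum_comp (finSumFinEquiv (m := 2) (n := 2)).symm fun i => ρ i i

end Density

/-! ### Operator norm and unitary diagonalization. -/

section OperatorNorm

open scoped Matrix.Norms.L2Operator

variable {𝕜 : Type*} [RCLike 𝕜]

theorem opNorm_eq_norm (X : Matrix (Fin 2) (Fin 2) 𝕜) : opNorm X = ‖X‖ :=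
  Matrix.l2_opNorm_toEuclideanCLM X

theorem opNorm_conjTranspose (X : Matrix (Fin 2) (Fin 2) 𝕜) : opNorm Xᴴ = opNorm X := by
  rw [opNorm_eq_norm, opNorm_eq_norm, Matrix.l2_opNorm_conjTranspose]

theorem opNorm_unitary_mul_mul {U V : Matrix (Fin 2) (Fin 2) 𝕜}
    (hU : U ∈ unitary (Matrix (Fin 2) (Fin 2) 𝕜)) (hV : V ∈ unitary (Matrix (Fin 2) (Fin 2) 𝕜))
    (X : Matrix (Fin 2) (Fin 2) 𝕜) : opNorm (U * X * V) = opNorm X := by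
  rw [opNorm_eq_norm, opNorm_eq_norm, CStarRing.norm_mul_mem_unitary _ hV,
    CStarRing.norm_mem_unitary_mul _ hU]

theorem continuous_opNorm : Continuous (opNorm : Matrix (Fin 2) (Fin 2) 𝕜 → ℝ) := by
  have : (opNorm : Matrix (Fin 2) (Fin 2) 𝕜 → ℝ) = fun X => ‖X‖ := funext opNorm_eq_norm
  rw [this]
  exact continuous_norm

theorem opNorm_smul (c : ℝ) (X : Matrix (Fin 2) (Fin 2) 𝕜) : opNorm (c • X) = |c| * opNorm X := by
  rw [opNorm, opNorm, RCLike.real_smul_eq_coe_smul (K := 𝕜), map_smul, norm_smul]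
  simp

theorem exists_unitary_eq_diagonal {n : Type*} [Fintype n] [DecidableEq n] {A : Matrix n n 𝕜}
    (hA : A.IsHermitian) : ∃ U ∈ unitary (Matrix n n 𝕜), ∃ μ : n → ℝ,
      A = U * Matrix.diagonal (fun i => (μ i : 𝕜)) * Uᴴ ∧
      ∀ f : ℝ → ℝ, cfc f A = U * Matrix.diagonal (fun i => (f (μ i) : 𝕜)) * Uᴴ := by
  refine ⟨hA.eigenvectorUnitary, hA.eigenvectorUnitary.2, hA.eigenvalues, ?_, fun f => ?_⟩
  · conv_lhs => rw [hA.spectral_theorem, Unitary.conjStarAlgAut_apply]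
    rfl
  · rw [hA.cfc_eq, Matrix.IsHermitian.cfc, Unitary.conjStarAlgAut_apply]
    rfl

theorem posDef_unitary_conj_diagonal {n : Type*} [Fintype n] [DecidableEq n] {U : Matrix n n 𝕜}
    (hU : U ∈ unitary (Matrix n n 𝕜)) (μ : n → ℝ) :
    (U * Matrix.diagonal (fun i => (μ i : 𝕜)) * Uᴴ).PosDef ↔ ∀ i, 0 < μ i := by
  have hu : IsUnit U := Unitary.isUnit_coe (U := ⟨U, hU⟩)
  have := Matrix.IsUnit.posDef_star_right_conjugate_iff hu
    (x := Matrix.diagonal (fun i => (μ i : 𝕜)))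
  rw [← Matrix.star_eq_conjTranspose, this, Matrix.posDef_diagonal_iff]
  simp

theorem smul_one_sub_unitary_conj {n : Type*} [Fintype n] [DecidableEq n] {U : Matrix n n 𝕜}
    (hU : U ∈ unitary (Matrix n n 𝕜)) (μ : n → ℝ) (c : ℝ) :
    c • 1 - U * Matrix.diagonal (fun i => (μ i : 𝕜)) * Uᴴ =
      U * Matrix.diagonal (fun i => ((c - μ i : ℝ) : 𝕜)) * Uᴴ := by
  have h : Matrix.diagonal (fun i => ((c - μ i : ℝ) : 𝕜)) =
      c • (1 : Matrix n n 𝕜) - Matrix.diagonal (fun i => (μ i : 𝕜)) := by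
    ext i j
    by_cases hij : i = j
    · subst hij
      simp [RCLike.real_smul_eq_coe_mul]
    · simp [hij]
  have hUU : U * Uᴴ = 1 := (Unitary.mem_iff.1 hU).2
  rw [h, mul_sub, sub_mul, Matrix.mul_smul, Matrix.smul_mul, mul_one, hUU]

theorem one_add_unitary_conj {n : Type*} [Fintype n] [DecidableEq n] {U : Matrix n n 𝕜}
    (hU : U ∈ unitary (Matrix n n 𝕜)) (μ : n → ℝ) :
    1 + U * Matrix.diagonal (fun i => (μ i : 𝕜)) * Uᴴ =
      U * Matrix.diagonal (fun i => ((1 + μ i : ℝ) : 𝕜)) * Uᴴ := by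
  have h : Matrix.diagonal (fun i => ((1 + μ i : ℝ) : 𝕜)) =
      1 + Matrix.diagonal (fun i => (μ i : 𝕜)) := by
    rw [← Matrix.diagonal_one, Matrix.diagonal_add]
    simp
  have hUU : U * Uᴴ = 1 := (Unitary.mem_iff.1 hU).2
  rw [h, mul_add, add_mul, mul_one, hUU]

theorem opNorm_sq_eq {X U : Matrix (Fin 2) (Fin 2) 𝕜} {μ : Fin 2 → ℝ}
    (hU : U ∈ unitary (Matrix (Fin 2) (Fin 2) 𝕜))
    (h : X * Xᴴ = U * Matrix.diagonal (fun i => (μ i : 𝕜)) * Uᴴ) :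
    opNorm X ^ 2 = ‖μ‖ := by
  have h1 : opNorm (X * Xᴴ) = opNorm X ^ 2 := by
    have := Matrix.l2_opNorm_conjTranspose_mul_self Xᴴ
    rw [Matrix.conjTranspose_conjTranspose, Matrix.l2_opNorm_conjTranspose] at this
    rw [opNorm_eq_norm, opNorm_eq_norm, this, pow_two]
  have hU' : Uᴴ ∈ unitary (Matrix (Fin 2) (Fin 2) 𝕜) := Unitary.star_mem hU
  rw [← h1, h, opNorm_unitary_mul_mul hU hU', opNorm_eq_norm, Matrix.l2_opNorm_diagonal]
  simp [Pi.norm_def]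

theorem eigenvalues_self_mul_conjTranspose_nonneg {n : Type*} [Fintype n] [DecidableEq n]
    {X U : Matrix n n 𝕜} {μ : n → ℝ} (hU : U ∈ unitary (Matrix n n 𝕜))
    (h : X * Xᴴ = U * Matrix.diagonal (fun i => (μ i : 𝕜)) * Uᴴ) (i : n) : 0 ≤ μ i := by
  have hu : IsUnit U := Unitary.isUnit_coe (U := ⟨U, hU⟩)
  have := Matrix.IsUnit.posSemidef_star_right_conjugate_iff hu
    (x := Matrix.diagonal (fun i => (μ i : 𝕜)))
  rw [Matrix.star_eq_conjTranspose, ← h, Matrix.posSemidef_diagonal_iff] at this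
  simpa using this.1 (Matrix.posSemidef_self_mul_conjTranspose X) i

/-- Diagonalizing $XX^*$ turns both sides into the statement that every eigenvalue is below $r^2$.
-/
theorem opNorm_lt_iff {X : Matrix (Fin 2) (Fin 2) 𝕜} {r : ℝ} (hr : 0 < r) :
    opNorm X < r ↔ (r ^ 2 • 1 - X * Xᴴ).PosDef := by
  obtain ⟨U, hU, μ, h, -⟩ :=
    exists_unitary_eq_diagonal (Matrix.isHermitian_mul_conjTranspose_self X)
  rw [h, smul_one_sub_unitary_conj hU, posDef_unitary_conj_diagonal hU,
    ← sq_lt_sq₀ (show 0 ≤ opNorm X from norm_nonneg _) hr.le, opNorm_sq_eq hU h,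
    pi_norm_lt_iff (by positivity)]
  refine forall_congr' fun i => ?_
  rw [Real.norm_of_nonneg (eigenvalues_self_mul_conjTranspose_nonneg hU h i), sub_pos]

theorem det_one_sub_unitary_conj {U : Matrix (Fin 2) (Fin 2) 𝕜} {μ : Fin 2 → ℝ}
    (hU : U ∈ unitary (Matrix (Fin 2) (Fin 2) 𝕜)) :
    (1 - U * Matrix.diagonal (fun i => (μ i : 𝕜)) * Uᴴ).det =
      (((1 - μ 0) * (1 - μ 1) : ℝ) : 𝕜) := by
  have := smul_one_sub_unitary_conj hU μ 1
  rw [one_smul] at this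
  have hUU : U * Uᴴ = 1 := (Unitary.mem_iff.1 hU).2
  rw [this, Matrix.det_mul, Matrix.det_mul_comm, ← Matrix.det_mul, mul_assoc, hUU, mul_one,
    Matrix.det_diagonal, Fin.prod_univ_two]
  simp

/-- The determinant is a product of factors $1-\mu_i\in(0,1]$, hence at most the factor of the
largest $\mu_i=\|X\|^2$. This drives the divergence of $\eta$. -/
theorem re_det_one_sub_le {X : Matrix (Fin 2) (Fin 2) 𝕜} (h1 : opNorm X < 1) :
    RCLike.re (1 - X * Xᴴ).det ≤ 1 - opNorm X ^ 2 := by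
  obtain ⟨U, hU, μ, h, -⟩ :=
    exists_unitary_eq_diagonal (Matrix.isHermitian_mul_conjTranspose_self X)
  have hμ := eigenvalues_self_mul_conjTranspose_nonneg hU h
  have hlt : ∀ i, μ i < 1 := fun i => by
    have h2 : ‖μ i‖ ≤ ‖μ‖ := norm_le_pi_norm μ i
    rw [← opNorm_sq_eq hU h, Real.norm_of_nonneg (hμ i)] at h2
    have h3 : 0 ≤ opNorm X := norm_nonneg _
    nlinarith
  have hle : ‖μ‖ ≤ 1 - (1 - μ 0) * (1 - μ 1) := by
    have h0 := hμ 0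
    have h1 := hμ 1
    have h0' := hlt 0
    have h1' := hlt 1
    rw [pi_norm_le_iff_of_nonneg (by nlinarith), Fin.forall_fin_two,
      Real.norm_of_nonneg h0, Real.norm_of_nonneg h1]
    constructor <;> nlinarith
  rw [opNorm_sq_eq hU h, h, det_one_sub_unitary_conj hU, RCLike.ofReal_re]
  linarith

end OperatorNorm

/-! ### Positivity and determinant of block states. -/

section Blocks

variable {𝕜 : Type*} [RCLike 𝕜]

/-- The Schur complement of the lower right block is $r^{-1}(r^2I-XX^*)$. The Schur criterion is
used for semidefiniteness, and the determinant factorization upgrades it to definiteness. -/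
theorem posDef_fromBlocks_one_iff {r : ℝ} (hr : 0 < r) {X : Matrix (Fin 2) (Fin 2) 𝕜} :
    (Matrix.fromBlocks (r • 1) X Xᴴ (r • 1)).PosDef ↔ opNorm X < r := by
  have hD : (r • 1 : Matrix (Fin 2) (Fin 2) 𝕜).PosDef := Matrix.PosDef.one.smul hr
  have hu : IsUnit (r • 1 : Matrix (Fin 2) (Fin 2) 𝕜) := hD.isUnit
  let _ := hu.invertible
  have hinv : (r • 1 : Matrix (Fin 2) (Fin 2) 𝕜)⁻¹ = r⁻¹ • 1 := by
    apply Matrix.inv_eq_right_inv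
    rw [Matrix.smul_mul, Matrix.mul_smul, smul_smul, mul_inv_cancel₀ hr.ne', one_smul, one_mul]
  have hschur : r • 1 - X * (r • 1 : Matrix (Fin 2) (Fin 2) 𝕜)⁻¹ * Xᴴ =
      r⁻¹ • (r ^ 2 • 1 - X * Xᴴ) := by
    rw [hinv, Matrix.mul_smul, Matrix.smul_mul, mul_one, smul_sub, smul_smul]
    congr 2
    field_simp
  have hS : (r⁻¹ • (r ^ 2 • 1 - X * Xᴴ)).PosDef ↔ (r ^ 2 • 1 - X * Xᴴ).PosDef := by
    refine ⟨fun h => ?_, fun h => h.smul (inv_pos.2 hr)⟩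
    have := h.smul hr
    rwa [smul_smul, mul_inv_cancel₀ hr.ne', one_smul] at this
  have hdet : (Matrix.fromBlocks (r • 1) X Xᴴ (r • 1)).det =
      (r • 1 : Matrix (Fin 2) (Fin 2) 𝕜).det * (r⁻¹ • (r ^ 2 • 1 - X * Xᴴ)).det := by
    rw [Matrix.det_fromBlocks₂₂, Matrix.invOf_eq_nonsing_inv, hschur]
  have hne : (r • 1 : Matrix (Fin 2) (Fin 2) 𝕜).det ≠ 0 := hD.det_pos.ne'
  rw [opNorm_lt_iff hr, ← hS]
  constructor
  · intro h
    have h1 := (Matrix.PosDef.fromBlocks₂₂ _ _ hD).1 h.posSemidef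
    rw [hschur] at h1
    rw [h1.posDef_iff_det_ne_zero]
    have := h.det_pos.ne'
    rw [hdet] at this
    exact right_ne_zero_of_mul this
  · intro h
    have h1 := h.posSemidef
    rw [← hschur, ← Matrix.PosDef.fromBlocks₂₂ _ _ hD] at h1
    rw [h1.posDef_iff_det_ne_zero, hdet]
    exact mul_ne_zero hne h.det_pos.ne'

theorem fromBlocks_congr (G H X : Matrix (Fin 2) (Fin 2) 𝕜) (r : ℝ) :
    blockState (r • (G * Gᴴ)) (r • (H * Hᴴ)) (G * X * Hᴴ) =
      Matrix.fromBlocks G 0 0 H * Matrix.fromBlocks (r • 1) X Xᴴ (r • 1) *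
        star (Matrix.fromBlocks G 0 0 H) := by
  rw [Matrix.star_eq_conjTranspose, Matrix.fromBlocks_conjTranspose, Matrix.fromBlocks_multiply,
    Matrix.fromBlocks_multiply, blockState]
  simp [Matrix.mul_assoc]

theorem isUnit_fromBlocks_diag {G H : Matrix (Fin 2) (Fin 2) 𝕜} (hG : IsUnit G) (hH : IsUnit H) :
    IsUnit (Matrix.fromBlocks G 0 0 H) := by
  rw [Matrix.isUnit_iff_isUnit_det] at *
  rw [Matrix.det_fromBlocks_zero₂₁]
  exact hG.mul hH

theorem posDef_blockState_smul_iff {G H X : Matrix (Fin 2) (Fin 2) 𝕜} (hG : IsUnit G)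
    (hH : IsUnit H) {r : ℝ} (hr : 0 < r) :
    (blockState (r • (G * Gᴴ)) (r • (H * Hᴴ)) (G * X * Hᴴ)).PosDef ↔ opNorm X < r := by
  rw [fromBlocks_congr,
    Matrix.IsUnit.posDef_star_right_conjugate_iff (isUnit_fromBlocks_diag hG hH),
    posDef_fromBlocks_one_iff hr]

theorem posDef_blockState_iff {G H X : Matrix (Fin 2) (Fin 2) 𝕜} (hG : IsUnit G)
    (hH : IsUnit H) :
    (blockState (G * Gᴴ) (H * Hᴴ) (G * X * Hᴴ)).PosDef ↔ opNorm X < 1 := by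
  simpa using posDef_blockState_smul_iff hG hH (X := X) one_pos

theorem det_mul_mul_conjTranspose (G A : Matrix (Fin 2) (Fin 2) 𝕜) :
    (G * A * Gᴴ).det = ((‖G.det‖ ^ 2 : ℝ) : 𝕜) * A.det := by
  rw [Matrix.det_mul, Matrix.det_mul, Matrix.det_conjTranspose, RCLike.ofReal_pow,
    ← RCLike.mul_conj, RCLike.star_def]
  ring

theorem det_blockState (G H X : Matrix (Fin 2) (Fin 2) 𝕜) :
    RCLike.re (blockState (G * Gᴴ) (H * Hᴴ) (G * X * Hᴴ)).det =
      ‖G.det‖ ^ 2 * ‖H.det‖ ^ 2 * RCLike.re (1 - X * Xᴴ).det := by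
  have h := fromBlocks_congr G H X 1
  rw [one_smul, one_smul, one_smul] at h
  have hn : ∀ z : 𝕜, z * star z = ((‖z‖ ^ 2 : ℝ) : 𝕜) := fun z => by
    rw [RCLike.star_def, RCLike.mul_conj, RCLike.ofReal_pow]
  rw [h, Matrix.det_mul, Matrix.det_mul, Matrix.star_eq_conjTranspose, Matrix.det_conjTranspose,
    Matrix.det_fromBlocks_zero₂₁, Matrix.det_fromBlocks_one₂₂, mul_right_comm, hn,
    RCLike.re_ofReal_mul, norm_mul, mul_pow]

theorem invSqrt_isHermitian (D : Matrix (Fin 2) (Fin 2) 𝕜) : (invSqrt D).IsHermitian :=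
  cfc_predicate (fun x : ℝ => (√x)⁻¹) D

theorem invSqrt_mul_mul_invSqrt {D : Matrix (Fin 2) (Fin 2) 𝕜} (hD : D.PosDef) :
    invSqrt D * D * invSqrt D = 1 := by
  obtain ⟨U, hU, μ, h, hf⟩ := exists_unitary_eq_diagonal hD.1
  have hpos : ∀ i, 0 < μ i := by
    rw [← posDef_unitary_conj_diagonal hU, ← h]
    exact hD
  have hUU : Uᴴ * U = 1 := (Unitary.mem_iff.1 hU).1
  have hUU' : U * Uᴴ = 1 := (Unitary.mem_iff.1 hU).2
  have hmul : ∀ A B : Matrix (Fin 2) (Fin 2) 𝕜, U * A * Uᴴ * (U * B * Uᴴ) = U * (A * B) * Uᴴ := by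
    intro A B
    calc U * A * Uᴴ * (U * B * Uᴴ) = U * A * (Uᴴ * U) * (B * Uᴴ) := by simp only [mul_assoc]
      _ = _ := by rw [hUU]; simp only [mul_assoc, one_mul]
  rw [invSqrt, hf]
  conv_lhs => enter [1, 2]; rw [h]
  rw [hmul, hmul, Matrix.diagonal_mul_diagonal, Matrix.diagonal_mul_diagonal]
  have : (fun i => (((√(μ i))⁻¹ : ℝ) : 𝕜) * (μ i : 𝕜) * (((√(μ i))⁻¹ : ℝ) : 𝕜)) = fun _ => 1 := by
    funext i
    rw [← RCLike.ofReal_mul, ← RCLike.ofReal_mul, ← RCLike.ofReal_one]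
    congr 1
    have h1 := Real.mul_self_sqrt (hpos i).le
    have h2 := (Real.sqrt_pos.2 (hpos i)).ne'
    field_simp
    nlinarith
  rw [this, Matrix.diagonal_one, mul_one, hUU']

/-- This is the polar decomposition of $G$: the unitary factor is $(GG^*)^{-1/2}G$. Hence
$\|D_1^{-1/2}CD_2^{-1/2}\|$ equals $\|X\|$ for every choice of invertible factors $G,H$, not only
for the positive roots. -/
theorem invSqrt_mul_mem_unitary {G : Matrix (Fin 2) (Fin 2) 𝕜} (hG : IsUnit G) :
    invSqrt (G * Gᴴ) * G ∈ unitary (Matrix (Fin 2) (Fin 2) 𝕜) := by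
  have hD : (G * Gᴴ).PosDef := by
    have := (Matrix.IsUnit.posDef_star_right_conjugate_iff hG (x := 1)).2 Matrix.PosDef.one
    rwa [mul_one] at this
  have h : invSqrt (G * Gᴴ) * G * star (invSqrt (G * Gᴴ) * G) = 1 := by
    rw [star_mul, Matrix.star_eq_conjTranspose, Matrix.star_eq_conjTranspose,
      (invSqrt_isHermitian _).eq]
    simpa only [mul_assoc] using invSqrt_mul_mul_invSqrt hD
  exact Unitary.mem_iff.2 ⟨mul_eq_one_comm.1 h, h⟩

theorem opNorm_invSqrt_mul_mul {G H X : Matrix (Fin 2) (Fin 2) 𝕜} (hG : IsUnit G)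
    (hH : IsUnit H) :
    opNorm (invSqrt (G * Gᴴ) * (G * X * Hᴴ) * invSqrt (H * Hᴴ)) = opNorm X := by
  have h2 : star (invSqrt (H * Hᴴ) * H) = Hᴴ * invSqrt (H * Hᴴ) := by
    rw [star_mul, Matrix.star_eq_conjTranspose, Matrix.star_eq_conjTranspose,
      (invSqrt_isHermitian _).eq]
  have := opNorm_unitary_mul_mul (invSqrt_mul_mem_unitary hG)
    (Unitary.star_mem (invSqrt_mul_mem_unitary hH)) X
  rw [h2] at this
  rw [← this]
  simp only [mul_assoc]

end Blocks

/-! ### Measurability of positivity conditions. -/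

section Measurability

variable {𝕜 : Type*} [RCLike 𝕜]

/-- Definiteness is semidefiniteness, a closed condition, together with a nonzero determinant, an
open one. The uncountable intersection over vectors is harmless because each member is closed. -/
theorem measurableSet_posDef {n α : Type*} [Fintype n] [DecidableEq n] [TopologicalSpace α]
    [MeasurableSpace α] [OpensMeasurableSpace α] {M : α → Matrix n n 𝕜} (hM : Continuous M) :
    MeasurableSet {x | (M x).PosDef} := by
  have h : {x | (M x).PosDef} = ({x | (M x)ᴴ = M x} ∩
      ⋂ v : n → 𝕜, {x | 0 ≤ RCLike.re (star v ⬝ᵥ (M x *ᵥ v))}) ∩ {x | (M x).det ≠ 0} := by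
    ext x
    simp only [Set.mem_ofPred_eq, Set.mem_inter_iff, Set.mem_iInter]
    refine ⟨fun h => ⟨⟨h.1, h.posSemidef.re_dotProduct_nonneg⟩, h.det_pos.ne'⟩, ?_⟩
    rintro ⟨⟨h1, h2⟩, h3⟩
    have hps : (M x).PosSemidef := by
      refine Matrix.PosSemidef.of_dotProduct_mulVec_nonneg h1 fun v => ?_
      rw [RCLike.nonneg_iff]
      exact ⟨h2 v, Matrix.IsHermitian.im_star_dotProduct_mulVec_self h1 v⟩
    exact hps.posDef_iff_det_ne_zero.2 h3
  rw [h]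
  refine MeasurableSet.inter (IsClosed.measurableSet ?_) (IsOpen.measurableSet ?_)
  · refine (isClosed_eq (by fun_prop) hM).inter (isClosed_iInter fun v => ?_)
    refine isClosed_le continuous_const (RCLike.continuous_re.comp ?_)
    exact continuous_const.dotProduct (hM.matrix_mulVec continuous_const)
  · exact isOpen_ne_fun hM.matrix_det continuous_const

end Measurability

/-! ### Jacobians of two-sided multiplications and of congruences. -/

section Jacobians

variable {𝕜 : Type*} [RCLike 𝕜]

theorem finrank_real_eq_one_or_two (𝕜 : Type*) [RCLike 𝕜] :
    Module.finrank ℝ 𝕜 = 1 ∨ Module.finrank ℝ 𝕜 = 2 := by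
  rcases RCLike.I_eq_zero_or_im_I_eq_one (K := 𝕜) with h | h
  · left
    rw [(RCLike.realLinearIsometryEquiv h).toLinearEquiv.finrank_eq, Module.finrank_self]
  · right
    rw [(RCLike.complexLinearIsometryEquiv h).toLinearEquiv.finrank_eq,
      Complex.finrank_real_complex]

/-- Conjugation preserves the norm of the field extension, and $z\bar z=|z|^2$ is real, so
$N(z)^2=|z|^{2d}$. This converts $\mathbb K$-determinants into real Jacobians. -/
theorem abs_algebraNorm (z : 𝕜) : |Algebra.norm ℝ z| = ‖z‖ ^ Module.finrank ℝ 𝕜 := by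
  have hconj : Algebra.norm ℝ ((starRingEnd 𝕜) z) = Algebra.norm ℝ z := by
    simpa using Algebra.norm_eq_of_algEquiv (RCLike.conjAe (K := 𝕜)) z
  have h : Algebra.norm ℝ (z * (starRingEnd 𝕜) z) = (‖z‖ ^ Module.finrank ℝ 𝕜) ^ 2 := by
    rw [RCLike.mul_conj, ← RCLike.ofReal_pow, ← RCLike.algebraMap_eq_ofReal,
      Algebra.norm_algebraMap]
    ring
  rw [map_mul, hconj, ← pow_two] at h
  rw [← abs_of_nonneg (show 0 ≤ ‖z‖ ^ Module.finrank ℝ 𝕜 by positivity)]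
  exact (sq_eq_sq_iff_abs_eq_abs _ _).1 h

/-- An invertible linear map is a measurable embedding, so no measurability of the integrand is
required. -/
theorem lintegral_eq_abs_det_mul_lintegral_comp {E : Type*} [NormedAddCommGroup E]
    [NormedSpace ℝ E] [MeasurableSpace E] [BorelSpace E] [FiniteDimensional ℝ E] (μ : Measure E)
    [μ.IsAddHaarMeasure] {f : E →ₗ[ℝ] E} (hf : LinearMap.det f ≠ 0) (g : E → ℝ≥0∞) :
    ∫⁻ x, g x ∂μ = ENNReal.ofReal |LinearMap.det f| * ∫⁻ x, g (f x) ∂μ := by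
  have hemb : MeasurableEmbedding f := by
    let e := LinearEquiv.ofIsUnitDet (f := f) (v := Module.finBasis ℝ E)
      (v' := Module.finBasis ℝ E) (by rw [LinearMap.det_toMatrix]; exact hf.isUnit)
    exact e.toContinuousLinearEquiv.toHomeomorph.measurableEmbedding
  rw [← hemb.lintegral_map, Measure.map_linearMap_addHaar_eq_smul_addHaar μ hf,
    lintegral_smul_measure, smul_eq_mul, ← mul_assoc, ← ENNReal.ofReal_mul (abs_nonneg _),
    ← abs_mul, mul_inv_cancel₀ hf, abs_one, ENNReal.ofReal_one, one_mul]

/-- Right multiplication on `2 × 2` arrays. -/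
def rowMul (B : Matrix (Fin 2) (Fin 2) 𝕜) : (Fin 2 → Fin 2 → 𝕜) →ₗ[𝕜] (Fin 2 → Fin 2 → 𝕜) :=
  LinearMap.pi fun i => B.vecMulLinear.comp (LinearMap.proj i)

theorem of_rowMul (B : Matrix (Fin 2) (Fin 2) 𝕜) (X : Fin 2 → Fin 2 → 𝕜) :
    Matrix.of (rowMul B X) = Matrix.of X * B := by
  ext i j
  simp [rowMul, Matrix.vecMul, dotProduct, Matrix.mul_apply]

theorem det_rowMul (B : Matrix (Fin 2) (Fin 2) 𝕜) : LinearMap.det (rowMul B) = B.det ^ 2 := by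
  rw [rowMul, LinearMap.det_pi, Fin.prod_univ_two, ← pow_two]
  congr 1
  rw [← Matrix.mulVecLin_transpose, ← Matrix.toLin'_apply', LinearMap.det_toLin',
    Matrix.det_transpose]

/-- Transposition of `2 × 2` arrays. -/
def swapArray (𝕜 : Type*) [RCLike 𝕜] : (Fin 2 → Fin 2 → 𝕜) ≃ₗ[𝕜] (Fin 2 → Fin 2 → 𝕜) where
  toFun X i j := X j i
  invFun X i j := X j i
  map_add' _ _ := rfl
  map_smul' _ _ := rfl

/-- The map `X ↦ A X B` on `2 × 2` arrays. -/
def sandwich (A B : Matrix (Fin 2) (Fin 2) 𝕜) :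
    (Fin 2 → Fin 2 → 𝕜) →ₗ[ℝ] (Fin 2 → Fin 2 → 𝕜) :=
  (((swapArray 𝕜 : (Fin 2 → Fin 2 → 𝕜) →ₗ[𝕜] _) ∘ₗ rowMul Aᵀ ∘ₗ
    ((swapArray 𝕜).symm : (Fin 2 → Fin 2 → 𝕜) →ₗ[𝕜] _)) ∘ₗ rowMul B).restrictScalars ℝ

theorem of_sandwich (A B : Matrix (Fin 2) (Fin 2) 𝕜) (X : Fin 2 → Fin 2 → 𝕜) :
    Matrix.of (sandwich A B X) = A * Matrix.of X * B := by
  have h : ∀ Y, Matrix.of (swapArray 𝕜 Y) = (Matrix.of Y)ᵀ := fun Y => rfl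
  have h' : ∀ Y, Matrix.of ((swapArray 𝕜).symm Y) = (Matrix.of Y)ᵀ := fun Y => rfl
  change Matrix.of (swapArray 𝕜 (rowMul Aᵀ ((swapArray 𝕜).symm (rowMul B X)))) = _
  rw [h, of_rowMul, h', of_rowMul, Matrix.transpose_mul, Matrix.transpose_transpose,
    Matrix.transpose_transpose, Matrix.mul_assoc]

theorem abs_det_sandwich (A B : Matrix (Fin 2) (Fin 2) 𝕜) :
    |LinearMap.det (sandwich A B)| = (‖A.det‖ ^ 2 * ‖B.det‖ ^ 2) ^ Module.finrank ℝ 𝕜 := by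
  rw [sandwich, LinearMap.det_restrictScalars, abs_algebraNorm, LinearMap.det_comp,
    LinearMap.det_conj, det_rowMul, det_rowMul, Matrix.det_transpose, norm_mul, norm_pow, norm_pow]

theorem herm_isHermitian (a c : ℝ) (b : 𝕜) : (herm a c b).IsHermitian := by
  ext i j
  fin_cases i <;> fin_cases j <;> simp [herm]

theorem herm_eq_of_isHermitian {M : Matrix (Fin 2) (Fin 2) 𝕜} (hM : M.IsHermitian) :
    herm (RCLike.re (M 0 0)) (RCLike.re (M 1 1)) (M 0 1) = M := by
  have h0 := hM.coe_re_apply_self 0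
  have h1 := hM.coe_re_apply_self 1
  have h2 := hM.apply 1 0
  ext i j
  fin_cases i <;> fin_cases j <;> simp_all [herm]

theorem herm_add (a c a' c' : ℝ) (b b' : 𝕜) :
    herm a c b + herm a' c' b' = herm (a + a') (c + c') (b + b') := by
  ext i j
  fin_cases i <;> fin_cases j <;> simp [herm]

theorem herm_smul (t a c : ℝ) (b : 𝕜) : t • herm a c b = herm (t * a) (t * c) (t • b) := by
  ext i j
  fin_cases i <;> fin_cases j <;> simp [herm, RCLike.real_smul_eq_coe_mul]

/-- The map `Y ↦ A Y Aᴴ` in the coordinates of self-adjoint `2 × 2` matrices. -/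
def hermCongr (A : Matrix (Fin 2) (Fin 2) 𝕜) : (ℝ × ℝ × 𝕜) →ₗ[ℝ] (ℝ × ℝ × 𝕜) where
  toFun y :=
    (RCLike.re ((A * herm y.1 y.2.1 y.2.2 * Aᴴ) 0 0),
      RCLike.re ((A * herm y.1 y.2.1 y.2.2 * Aᴴ) 1 1), (A * herm y.1 y.2.1 y.2.2 * Aᴴ) 0 1)
  map_add' x y := by
    simp only [Prod.fst_add, Prod.snd_add, ← herm_add, mul_add, add_mul, Matrix.add_apply, map_add,
      Prod.mk_add_mk]
  map_smul' t y := by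
    simp only [Prod.smul_fst, Prod.smul_snd, smul_eq_mul, ← herm_smul, Matrix.mul_smul,
      Matrix.smul_mul, Matrix.smul_apply, RCLike.smul_re, Prod.smul_mk, RingHom.id_apply]

theorem herm_hermCongr (A : Matrix (Fin 2) (Fin 2) 𝕜) (y : ℝ × ℝ × 𝕜) :
    herm (hermCongr A y).1 (hermCongr A y).2.1 (hermCongr A y).2.2 =
      A * herm y.1 y.2.1 y.2.2 * Aᴴ :=
  herm_eq_of_isHermitian (Matrix.isHermitian_mul_mul_conjTranspose A (herm_isHermitian _ _ _))

theorem herm_injective {x y : ℝ × ℝ × 𝕜} (h : herm x.1 x.2.1 x.2.2 = herm y.1 y.2.1 y.2.2) :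
    x = y := by
  have h00 := congrFun (congrFun h 0) 0
  have h11 := congrFun (congrFun h 1) 1
  have h01 := congrFun (congrFun h 0) 1
  simp only [herm, Matrix.of_apply, Matrix.cons_val', Matrix.cons_val_zero, Matrix.cons_val_one,
    Matrix.cons_val_fin_one, RCLike.ofReal_inj] at h00 h11 h01
  exact Prod.ext h00 (Prod.ext h11 h01)

theorem hermCongr_mul (A B : Matrix (Fin 2) (Fin 2) 𝕜) :
    hermCongr (A * B) = hermCongr A ∘ₗ hermCongr B := by
  refine LinearMap.ext fun y => herm_injective ?_
  rw [LinearMap.comp_apply, herm_hermCongr, herm_hermCongr, herm_hermCongr,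
    Matrix.conjTranspose_mul]
  simp only [mul_assoc]

theorem hermCongr_one : hermCongr (1 : Matrix (Fin 2) (Fin 2) 𝕜) = LinearMap.id := by
  refine LinearMap.ext fun y => herm_injective ?_
  rw [herm_hermCongr]
  simp

theorem hermCongr_diagonal (μ : Fin 2 → ℝ) :
    hermCongr (Matrix.diagonal fun i => (μ i : 𝕜)) =
      LinearMap.prodMap (μ 0 ^ 2 • LinearMap.id)
        (LinearMap.prodMap (μ 1 ^ 2 • LinearMap.id) ((μ 0 * μ 1) • LinearMap.id)) := by
  refine LinearMap.ext fun y => herm_injective ?_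
  rw [herm_hermCongr]
  ext i j
  fin_cases i <;> fin_cases j <;>
    simp [herm, Matrix.mul_apply, Matrix.diagonal_apply,
      RCLike.real_smul_eq_coe_mul] <;> ring

/-- After diagonalization the two diagonal coordinates scale by $\mu_0^2$ and $\mu_1^2$, and the $d$
off-diagonal real coordinates by $\mu_0\mu_1$. The unitary contributions cancel. -/
theorem det_hermCongr {A : Matrix (Fin 2) (Fin 2) 𝕜} (hA : A.IsHermitian) :
    LinearMap.det (hermCongr A) = (RCLike.re A.det) ^ (2 + Module.finrank ℝ 𝕜) := by
  obtain ⟨U, hU, μ, h, -⟩ := exists_unitary_eq_diagonal hA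
  have hUU : Uᴴ * U = 1 := (Unitary.mem_iff.1 hU).1
  have h1 : LinearMap.det (hermCongr Uᴴ) * LinearMap.det (hermCongr U) = 1 := by
    rw [← LinearMap.det_comp, ← hermCongr_mul, hUU, hermCongr_one, LinearMap.det_id]
  have hdet : RCLike.re A.det = μ 0 * μ 1 := by
    rw [h, Matrix.det_mul_comm, ← mul_assoc, hUU, one_mul,
      Matrix.det_diagonal, Fin.prod_univ_two, ← RCLike.ofReal_mul, RCLike.ofReal_re]
  rw [hdet, h, hermCongr_mul, hermCongr_mul, LinearMap.det_comp, LinearMap.det_comp,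
    hermCongr_diagonal, LinearMap.det_prodMap, LinearMap.det_prodMap, LinearMap.det_smul,
    LinearMap.det_smul, LinearMap.det_smul]
  simp only [Module.finrank_self, LinearMap.det_id, pow_one, mul_one]
  linear_combination (μ 0 ^ 2 * μ 1 ^ 2 * (μ 0 * μ 1) ^ Module.finrank ℝ 𝕜) * h1

end Jacobians

/-! ### Singular values of a Hermitian two by two matrix. -/

section SingularValues

variable {𝕜 : Type*} [RCLike 𝕜]

theorem exists_unitary_eq_diagonal_sorted {A : Matrix (Fin 2) (Fin 2) 𝕜} (hA : A.IsHermitian) :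
    ∃ U ∈ unitary (Matrix (Fin 2) (Fin 2) 𝕜), ∃ μ : Fin 2 → ℝ, μ 1 ≤ μ 0 ∧
      A = U * Matrix.diagonal (fun i => (μ i : 𝕜)) * Uᴴ ∧
      ∀ f : ℝ → ℝ, cfc f A = U * Matrix.diagonal (fun i => (f (μ i) : 𝕜)) * Uᴴ := by
  obtain ⟨U, hU, μ, h, hf⟩ := exists_unitary_eq_diagonal hA
  rcases le_total (μ 1) (μ 0) with hle | hle
  · exact ⟨U, hU, μ, hle, h, hf⟩
  · let P : Matrix (Fin 2) (Fin 2) 𝕜 := !![0, 1; 1, 0]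
    have hP : P ∈ unitary (Matrix (Fin 2) (Fin 2) 𝕜) := by
      rw [Unitary.mem_iff]
      constructor <;> ext i j <;> fin_cases i <;> fin_cases j <;>
        simp [P, Matrix.star_eq_conjTranspose, Matrix.mul_apply]
    have hconj : ∀ a : Fin 2 → 𝕜, Matrix.diagonal a =
        P * Matrix.diagonal (fun i => a (Equiv.swap 0 1 i)) * Pᴴ := by
      intro a
      ext i j
      fin_cases i <;> fin_cases j <;>
        simp [P, Matrix.mul_apply, Matrix.vecMul, dotProduct, Matrix.diagonal_apply]
    have key : ∀ a : Fin 2 → 𝕜, U * Matrix.diagonal a * Uᴴ =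
        (U * P) * Matrix.diagonal (fun i => a (Equiv.swap 0 1 i)) * (U * P)ᴴ := by
      intro a
      rw [hconj a, Matrix.conjTranspose_mul]
      simp only [mul_assoc]
    refine ⟨U * P, mul_mem hU hP, fun i => μ (Equiv.swap 0 1 i), by simpa using hle, ?_,
      fun f => ?_⟩
    · exact h.trans (key fun i => (μ i : 𝕜))
    · exact (hf f).trans (key fun i => (f (μ i) : 𝕜))

/-- The trace and determinant of $M^*M$ determine the unordered pair of squared singular values.
Nonnegativity and the decreasing order then fix which is which. -/
theorem singularValueRatio_unitary_conj_diagonal {U : Matrix (Fin 2) (Fin 2) 𝕜}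
    (hU : U ∈ unitary (Matrix (Fin 2) (Fin 2) 𝕜)) {z : Fin 2 → ℝ} (h0 : 0 < z 0)
    (hz : z 0 ≤ z 1) :
    singularValueRatio (U * Matrix.diagonal (fun i => (z i : 𝕜)) * Uᴴ) = z 0 / z 1 := by
  set M := U * Matrix.diagonal (fun i => (z i : 𝕜)) * Uᴴ with hM
  have hUU : Uᴴ * U = 1 := (Unitary.mem_iff.1 hU).1
  have hMM : Mᴴ * M = U * Matrix.diagonal (fun i => ((z i ^ 2 : ℝ) : 𝕜)) * Uᴴ := by
    have hd : (fun i => ((z i ^ 2 : ℝ) : 𝕜)) = fun i => (z i : 𝕜) * (z i : 𝕜) := by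
      funext i
      rw [pow_two, RCLike.ofReal_mul]
    have hMH : Mᴴ = M := by
      rw [hM]
      simp only [Matrix.conjTranspose_mul, Matrix.conjTranspose_conjTranspose,
        Matrix.diagonal_conjTranspose, mul_assoc]
      congr 3
      ext i
      simp
    rw [hMH, hM, hd, ← Matrix.diagonal_mul_diagonal]
    calc _ = U * Matrix.diagonal (fun i => (z i : 𝕜)) * (Uᴴ * U) *
          (Matrix.diagonal (fun i => (z i : 𝕜)) * Uᴴ) := by simp only [mul_assoc]
      _ = _ := by rw [hUU]; simp only [mul_assoc, one_mul]
  set T := M.toEuclideanLin with hT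
  have hTT : LinearMap.adjoint T ∘ₗ T = (Mᴴ * M).toEuclideanLin := by
    rw [hT, ← Matrix.toEuclideanLin_conjTranspose_eq_adjoint]
    exact (Matrix.toLpLin_mul_same 2 Mᴴ M).symm
  have hn : Module.finrank 𝕜 (EuclideanSpace 𝕜 (Fin 2)) = 2 := by simp
  have hs := T.isSymmetric_adjoint_comp_self
  have hdet := hs.det_eq_prod_eigenvalues hn
  have htr := hs.trace_eq_sum_eigenvalues hn
  rw [Fin.prod_univ_two, ← T.sq_singularValues_fin hn, ← T.sq_singularValues_fin hn] at hdet
  rw [Fin.sum_univ_two, ← T.sq_singularValues_fin hn, ← T.sq_singularValues_fin hn] at htr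
  have hdet' : LinearMap.det (LinearMap.adjoint T ∘ₗ T) = ((z 0 ^ 2 * z 1 ^ 2 : ℝ) : 𝕜) := by
    rw [hTT, Matrix.toEuclideanLin, LinearMap.det_toLpLin, hMM, Matrix.det_mul_comm, ← mul_assoc,
      hUU, one_mul, Matrix.det_diagonal, Fin.prod_univ_two, RCLike.ofReal_mul]
  have htr' : LinearMap.trace 𝕜 _ (LinearMap.adjoint T ∘ₗ T) =
      ((z 0 ^ 2 + z 1 ^ 2 : ℝ) : 𝕜) := by
    rw [hTT, Matrix.toEuclideanLin_eq_toLin_orthonormal, Matrix.trace_toLin_eq, hMM,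
      Matrix.trace_mul_comm, ← mul_assoc, hUU, one_mul, Matrix.trace_diagonal, Fin.sum_univ_two,
      RCLike.ofReal_add]
  rw [hdet'] at hdet
  rw [htr'] at htr
  have hanti : T.singularValues 1 ≤ T.singularValues 0 := T.singularValues_antitone zero_le_one
  have hnn := T.singularValues_nonneg 1
  simp only [Fin.coe_ofNat_eq_mod, Nat.zero_mod, Nat.one_mod] at hdet htr
  have hd : z 0 ^ 2 * z 1 ^ 2 = T.singularValues 0 ^ 2 * T.singularValues 1 ^ 2 := by
    exact_mod_cast hdet
  have ht : z 0 ^ 2 + z 1 ^ 2 = T.singularValues 0 ^ 2 + T.singularValues 1 ^ 2 := by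
    exact_mod_cast htr
  have hz1 : 0 < z 1 := h0.trans_le hz
  have e0 : T.singularValues 1 = z 0 := by
    -- Vieta: equal sum and product make the squared singular value a root of $(x-z_0^2)(x-z_1^2)$.
    have hfac : (T.singularValues 1 ^ 2 - z 0 ^ 2) * (T.singularValues 1 ^ 2 - z 1 ^ 2) = 0 := by
      linear_combination T.singularValues 1 ^ 2 * (-ht) + hd
    rcases mul_eq_zero.1 hfac with h | h
    · exact (sq_eq_sq₀ hnn h0.le).1 (sub_eq_zero.1 h)
    · have h1 : T.singularValues 1 = z 1 := (sq_eq_sq₀ hnn hz1.le).1 (sub_eq_zero.1 h)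
      have h2 : T.singularValues 0 = z 0 := by
        refine (sq_eq_sq₀ (hnn.trans hanti) h0.le).1 ?_
        rw [h1] at ht
        linarith
      linarith
  have e1 : T.singularValues 0 = z 1 := by
    refine (sq_eq_sq₀ (hnn.trans hanti) hz1.le).1 ?_
    rw [e0] at ht
    linarith
  rw [singularValueRatio, ← hT, e0, e1]

end SingularValues

/-! ### Separability as positivity of block matrices. -/

section Separable

variable {𝕜 : Type*} [RCLike 𝕜]

theorem trace_blockState (D₁ D₂ C : Matrix (Fin 2) (Fin 2) 𝕜) :
    (blockState D₁ D₂ C).trace = D₁.trace + D₂.trace := by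
  simp [blockState, Matrix.trace, Fintype.sum_sum_type]

theorem mem_separableStates_iff {D₁ D₂ C : Matrix (Fin 2) (Fin 2) 𝕜} :
    blockState D₁ D₂ C ∈ separableStates 𝕜 ↔
      (blockState D₁ D₂ C).PosDef ∧ (blockState D₁ D₂ Cᴴ).PosDef ∧ (D₁ + D₂).trace = 1 := by
  rw [Matrix.trace_add]
  constructor
  · rintro ⟨⟨σ, hσ, hinv⟩, h⟩
    have hσ' : σ = blockState D₁ D₂ Cᴴ := by
      have h11 := congrArg Matrix.toBlocks₁₁ hinv
      have h22 := congrArg Matrix.toBlocks₂₂ hinv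
      have h12 := congrArg Matrix.toBlocks₁₂ hinv
      simp only [involution, blockState, Matrix.toBlocks_fromBlocks₁₁,
        Matrix.toBlocks_fromBlocks₂₂, Matrix.toBlocks_fromBlocks₁₂] at h11 h22 h12
      have h12' : σ.toBlocks₁₂ = Cᴴ := by rw [← h12, Matrix.conjTranspose_conjTranspose]
      have h21 : σ.toBlocks₂₁ = Cᴴᴴ := by
        rw [← h12']
        ext i j
        exact (hσ.1.1.apply _ _).symm
      rw [blockState, ← h11, ← h22, ← h21, ← h12', Matrix.fromBlocks_toBlocks]
    exact ⟨h.1, hσ' ▸ hσ.1, by rw [← trace_blockState D₁ D₂ C]; exact h.2⟩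
  · rintro ⟨h1, h2, h3⟩
    refine ⟨⟨blockState D₁ D₂ Cᴴ, ⟨h2, by rw [trace_blockState, h3]⟩, ?_⟩, h1,
      by rw [trace_blockState, h3]⟩
    simp [involution, blockState]

theorem isUnit_of_mul_conjTranspose {G : Matrix (Fin 2) (Fin 2) 𝕜} (h : (G * Gᴴ).PosDef) :
    IsUnit G := by
  have := (Matrix.isUnit_iff_isUnit_det _).1 h.isUnit
  rw [Matrix.det_mul] at this
  exact (Matrix.isUnit_iff_isUnit_det _).2 (isUnit_of_mul_isUnit_left this)

theorem posDef_of_blockState {D₁ D₂ C : Matrix (Fin 2) (Fin 2) 𝕜}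
    (h : (blockState D₁ D₂ C).PosDef) : D₁.PosDef ∧ D₂.PosDef :=
  ⟨h.submatrix (e := Sum.inl) Sum.inl_injective, h.submatrix (e := Sum.inr) Sum.inr_injective⟩

theorem exists_factorization {D₁ D₂ C : Matrix (Fin 2) (Fin 2) 𝕜} (h1 : D₁.PosDef)
    (h2 : D₂.PosDef) : ∃ G H X : Matrix (Fin 2) (Fin 2) 𝕜, IsUnit G ∧ IsUnit H ∧
      D₁ = G * Gᴴ ∧ D₂ = H * Hᴴ ∧ C = G * X * Hᴴ := by
  obtain ⟨G, hG, rfl⟩ := exists_posDef_mul_self_eq h1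
  obtain ⟨H, hH, rfl⟩ := exists_posDef_mul_self_eq h2
  have hGu : IsUnit G.det := (Matrix.isUnit_iff_isUnit_det _).1 hG.isUnit
  have hHu : IsUnit H.det := (Matrix.isUnit_iff_isUnit_det _).1 hH.isUnit
  refine ⟨G, H, G⁻¹ * C * H⁻¹, hG.isUnit, hH.isUnit, by rw [hG.1.eq], by rw [hH.1.eq], ?_⟩
  rw [hH.1.eq, Matrix.mul_assoc, Matrix.mul_assoc _ H⁻¹, Matrix.nonsing_inv_mul _ hHu,
    Matrix.mul_one, Matrix.mul_nonsing_inv_cancel_left _ _ hGu]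

/-- Scaling the diagonal blocks by $r$ turns the norm bound into positivity. The condition no longer
involves functional calculus in $D_1,D_2$ and so becomes visibly measurable. -/
theorem mem_separableStatesBelow_iff {D₁ D₂ C : Matrix (Fin 2) (Fin 2) 𝕜} {r : ℝ} (hr : 0 < r) :
    blockState D₁ D₂ C ∈ separableStatesBelow 𝕜 r ↔
      (blockState D₁ D₂ C).PosDef ∧ (blockState D₁ D₂ Cᴴ).PosDef ∧
        (blockState (r • D₁) (r • D₂) C).PosDef ∧ (D₁ + D₂).trace = 1 := by
  have key : (blockState D₁ D₂ C).PosDef → (opNorm (invSqrt D₁ * C * invSqrt D₂) < r ↔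
      (blockState (r • D₁) (r • D₂) C).PosDef) := by
    intro h
    obtain ⟨h1, h2⟩ := posDef_of_blockState h
    obtain ⟨G, H, X, hG, hH, rfl, rfl, rfl⟩ := exists_factorization (C := C) h1 h2
    rw [opNorm_invSqrt_mul_mul hG hH, posDef_blockState_smul_iff hG hH hr]
  change _ ∧ opNorm (invSqrt D₁ * C * invSqrt D₂) < r ↔ _
  rw [mem_separableStates_iff]
  constructor
  · rintro ⟨⟨h1, h2, h3⟩, h4⟩
    exact ⟨h1, h2, (key h1).1 h4, h3⟩
  · rintro ⟨h1, h2, h4, h3⟩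
    exact ⟨⟨h1, h2, h3⟩, (key h1).2 h4⟩

theorem eq_blockState {ρ : BlockMatrix 𝕜} (h : ρ.IsHermitian) :
    ρ = blockState ρ.toBlocks₁₁ ρ.toBlocks₂₂ ρ.toBlocks₁₂ := by
  have h21 : ρ.toBlocks₂₁ = ρ.toBlocks₁₂ᴴ := by
    ext i j
    exact (h.apply _ _).symm
  rw [blockState, ← h21, Matrix.fromBlocks_toBlocks]

/-- For $r=1$ the norm bound is already implied by positivity of the state. -/
theorem separableStatesBelow_one : separableStatesBelow 𝕜 1 = separableStates 𝕜 := by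
  ext ρ
  refine ⟨fun h => h.1, fun h => ?_⟩
  obtain ⟨D₁, D₂, C, rfl⟩ : ∃ D₁ D₂ C, ρ = blockState D₁ D₂ C := ⟨_, _, _, eq_blockState h.2.1.1⟩
  rw [mem_separableStatesBelow_iff one_pos, one_smul, one_smul]
  rw [mem_separableStates_iff] at h
  exact ⟨h.1, h.2.1, h.1, h.2.2⟩

theorem measurableSet_separableStatesBelow {α : Type*} [TopologicalSpace α] [MeasurableSpace α]
    [OpensMeasurableSpace α] {D₁ D₂ C : α → Matrix (Fin 2) (Fin 2) 𝕜} (h1 : Continuous D₁)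
    (h2 : Continuous D₂) (hC : Continuous C) {r : ℝ} (hr : 0 < r) :
    MeasurableSet {x | blockState (D₁ x) (D₂ x) (C x) ∈ separableStatesBelow 𝕜 r} := by
  simp only [mem_separableStatesBelow_iff hr]
  refine (measurableSet_posDef ?_).inter ((measurableSet_posDef ?_).inter
    ((measurableSet_posDef ?_).inter (IsClosed.measurableSet ?_)))
  · exact h1.matrix_fromBlocks hC hC.matrix_conjTranspose h2
  · exact h1.matrix_fromBlocks hC.matrix_conjTranspose
      hC.matrix_conjTranspose.matrix_conjTranspose h2
  · exact (h1.const_smul r).matrix_fromBlocks hC hC.matrix_conjTranspose (h2.const_smul r)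
  · exact isClosed_eq (h1.add h2).matrix_trace continuous_const

/-- The density of the metric of the square root, extended by zero outside of
`separableStatesBelow 𝕜 r`. -/
def densityBelow (r : ℝ) : BlockMatrix 𝕜 → ℝ≥0∞ :=
  (separableStatesBelow 𝕜 r).indicator fun ρ => ENNReal.ofReal (stateDensity Real.sqrt ρ)

theorem densityBelow_eq (r : ℝ) : densityBelow r = (separableStatesBelow 𝕜 r).indicator fun ρ =>
    ENNReal.ofReal (2 ^ (3 * Module.finrank ℝ 𝕜) *
      (RCLike.re ρ.det) ^ (-(3 * (Module.finrank ℝ 𝕜 : ℝ) / 4) - 1 / 2)) :=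
  Set.indicator_congr fun ρ hρ => by rw [stateDensity_sqrt hρ.1.2]

theorem measurable_densityBelow {α : Type*} [TopologicalSpace α] [MeasurableSpace α]
    [OpensMeasurableSpace α] {D₁ D₂ C : α → Matrix (Fin 2) (Fin 2) 𝕜} (h1 : Continuous D₁)
    (h2 : Continuous D₂) (hC : Continuous C) {r : ℝ} (hr : 0 < r) :
    Measurable fun x => densityBelow r (blockState (D₁ x) (D₂ x) (C x)) := by
  have hdet : Continuous fun x => RCLike.re (blockState (D₁ x) (D₂ x) (C x)).det :=
    RCLike.continuous_re.comp
      (h1.matrix_fromBlocks hC hC.matrix_conjTranspose h2).matrix_det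
  rw [densityBelow_eq]
  exact Measurable.indicator (ENNReal.measurable_ofReal.comp
    ((hdet.measurable.pow_const _).const_mul _))
    (measurableSet_separableStatesBelow h1 h2 hC hr)

end Separable

/-! ### Haar property of the coordinate measures. -/

section Instances

variable {𝕜 : Type*} [RCLike 𝕜] [MeasurableSpace 𝕜] [BorelSpace 𝕜]

instance isAddHaarMeasure_volume_array :
    (volume : Measure (Fin 2 → Fin 2 → 𝕜)).IsAddHaarMeasure :=
  Measure.pi.isAddHaarMeasure (fun _ : Fin 2 => (volume : Measure (Fin 2 → 𝕜)))

instance isAddHaarMeasure_volume_prod : (volume : Measure (ℝ × 𝕜)).IsAddHaarMeasure :=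
  Measure.prod.instIsAddHaarMeasure (volume : Measure ℝ) (volume : Measure 𝕜)

instance isAddHaarMeasure_volume_herm : (volume : Measure (ℝ × ℝ × 𝕜)).IsAddHaarMeasure :=
  Measure.prod.instIsAddHaarMeasure (volume : Measure ℝ) (volume : Measure (ℝ × 𝕜))

end Instances

/-! ### The integral over the off-diagonal block. -/

section InnerIntegral

variable {𝕜 : Type*} [RCLike 𝕜]

/-- The matrix `diag(1, ε)`. -/
def scaleMatrix (𝕜 : Type*) [RCLike 𝕜] (ε : ℝ) : Matrix (Fin 2) (Fin 2) 𝕜 :=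
  Matrix.diagonal ![1, (ε : 𝕜)]

theorem isUnit_scaleMatrix {ε : ℝ} (hε : ε ≠ 0) : IsUnit (scaleMatrix 𝕜 ε) := by
  rw [Matrix.isUnit_iff_isUnit_det, scaleMatrix, Matrix.det_diagonal, Fin.prod_univ_two]
  simpa using hε

theorem scaleMatrix_conjTranspose (ε : ℝ) : (scaleMatrix 𝕜 ε)ᴴ = scaleMatrix 𝕜 ε := by
  rw [scaleMatrix, Matrix.diagonal_conjTranspose]
  congr 1
  ext i
  fin_cases i <;> simp

theorem mem_separableStatesBelow_factorized_iff {G H X : Matrix (Fin 2) (Fin 2) 𝕜} {l ε r : ℝ}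
    (hG : IsUnit G) (hl : 0 < l) (hε : 0 < ε) (hr : 0 < r) (hr1 : r ≤ 1)
    (hH : H = G * l • scaleMatrix 𝕜 ε) (ht : (G * Gᴴ + H * Hᴴ).trace = 1) :
    blockState (G * Gᴴ) (H * Hᴴ) (G * X * Hᴴ) ∈ separableStatesBelow 𝕜 r ↔
      opNorm X < r ∧ opNorm ((scaleMatrix 𝕜 ε)⁻¹ * X * scaleMatrix 𝕜 ε) < 1 := by
  have hVu := isUnit_scaleMatrix (𝕜 := 𝕜) hε.ne'
  have hVd : IsUnit (scaleMatrix 𝕜 ε).det := (Matrix.isUnit_iff_isUnit_det _).1 hVu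
  have hHu : IsUnit H := by
    rw [hH, Matrix.mul_smul]
    exact (IsUnit.smul (Units.mk0 l hl.ne') (hG.mul hVu) :)
  -- The factor $l$ occurs once on each side, and $V$ is real diagonal, so
  -- $lGVX^*G^*=G(VX^*V^{-1})(lVG^*)$.
  have hC : (G * X * Hᴴ)ᴴ = G * ((scaleMatrix 𝕜 ε)⁻¹ * X * scaleMatrix 𝕜 ε)ᴴ * Hᴴ := by
    rw [hH]
    simp only [Matrix.conjTranspose_mul, Matrix.conjTranspose_conjTranspose,
      Matrix.conjTranspose_smul, scaleMatrix_conjTranspose, Matrix.conjTranspose_nonsing_inv,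
      star_trivial, Matrix.mul_smul, mul_assoc]
    rw [Matrix.nonsing_inv_mul_cancel_left _ _ hVd]
  rw [mem_separableStatesBelow_iff hr, hC, posDef_blockState_iff hG hHu,
    posDef_blockState_iff hG hHu, posDef_blockState_smul_iff hG hHu hr, opNorm_conjTranspose]
  exact ⟨fun h => ⟨h.2.2.1, h.2.1⟩, fun h => ⟨h.1.trans_le hr1, h.2, h.1, ht⟩⟩

variable [MeasurableSpace 𝕜] [BorelSpace 𝕜]

/-- Substitute $C=GXH^*$ and put $p=\det D_1\det D_2$. The Jacobian $p^d$ meets the density factor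
$p^{-3d/4-1/2}$ and leaves $p^{d/4-1/2}$. -/
theorem lintegral_densityBelow_factorized {G H : Matrix (Fin 2) (Fin 2) 𝕜} {l ε r : ℝ}
    (hG : IsUnit G) (hl : 0 < l) (hε : 0 < ε) (hr : 0 < r) (hr1 : r ≤ 1)
    (hH : H = G * l • scaleMatrix 𝕜 ε) (ht : (G * Gᴴ + H * Hᴴ).trace = 1) :
    ∫⁻ C : Fin 2 → Fin 2 → 𝕜, densityBelow r (blockState (G * Gᴴ) (H * Hᴴ) (Matrix.of C)) =
      ENNReal.ofReal (2 ^ (3 * Module.finrank ℝ 𝕜) *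
        (‖G.det‖ ^ 2 * ‖H.det‖ ^ 2) ^ ((Module.finrank ℝ 𝕜 : ℝ) / 4 - 1 / 2)) *
        etaBelow 𝕜 r ε := by
  have hHu : IsUnit H := by
    rw [hH, Matrix.mul_smul]
    exact (IsUnit.smul (Units.mk0 l hl.ne') (hG.mul (isUnit_scaleMatrix hε.ne')) :)
  have hGd : 0 < ‖G.det‖ := norm_pos_iff.2 ((Matrix.isUnit_iff_isUnit_det _).1 hG).ne_zero
  have hHd : 0 < ‖H.det‖ := norm_pos_iff.2 ((Matrix.isUnit_iff_isUnit_det _).1 hHu).ne_zero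
  set p := ‖G.det‖ ^ 2 * ‖H.det‖ ^ 2 with hp
  have hp0 : 0 < p := by positivity
  set d := Module.finrank ℝ 𝕜
  have habs : |LinearMap.det (sandwich G Hᴴ)| = p ^ d := by
    rw [abs_det_sandwich, Matrix.det_conjTranspose, norm_star]
  have hne : LinearMap.det (sandwich G Hᴴ) ≠ 0 := by
    rw [← abs_pos, habs]
    positivity
  have hset : MeasurableSet {X : Fin 2 → Fin 2 → 𝕜 | opNorm (Matrix.of X) < r ∧
      opNorm ((Matrix.diagonal ![1, (ε : 𝕜)])⁻¹ * Matrix.of X *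
        Matrix.diagonal ![1, (ε : 𝕜)]) < 1} := by
    have hof : Continuous fun X : Fin 2 → Fin 2 → 𝕜 => Matrix.of X := continuous_id
    refine (IsOpen.measurableSet ?_).inter (IsOpen.measurableSet ?_)
    · exact isOpen_lt (continuous_opNorm.comp hof) continuous_const
    · exact isOpen_lt (continuous_opNorm.comp
        ((continuous_const.matrix_mul hof).matrix_mul continuous_const)) continuous_const
  rw [lintegral_eq_abs_det_mul_lintegral_comp volume hne, habs, etaBelow,
    ← lintegral_indicator hset, ← lintegral_const_mul' _ _ ENNReal.ofReal_ne_top,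
    ← lintegral_const_mul' _ _ ENNReal.ofReal_ne_top]
  refine lintegral_congr fun X => ?_
  rw [of_sandwich, densityBelow_eq]
  have hiff := mem_separableStatesBelow_factorized_iff (X := Matrix.of X) hG hl hε hr hr1 hH ht
  by_cases hX : blockState (G * Gᴴ) (H * Hᴴ) (G * Matrix.of X * Hᴴ) ∈ separableStatesBelow 𝕜 r
  · have hX' := hiff.1 hX
    rw [Set.indicator_of_mem hX, Set.indicator_of_mem (by exact hX'), det_blockState, ← hp,
      ← ENNReal.ofReal_mul (by positivity), ← ENNReal.ofReal_mul (by positivity)]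
    congr 1
    have hφ : 0 < RCLike.re (1 - Matrix.of X * (Matrix.of X)ᴴ).det := by
      have := (opNorm_lt_iff one_pos).1 (hX'.1.trans_le hr1)
      rw [one_pow, one_smul] at this
      exact (RCLike.pos_iff.1 this.det_pos).1
    rw [Real.mul_rpow hp0.le hφ.le]
    have hexp : p ^ ((d : ℝ) / 4 - 1 / 2) = p ^ d * p ^ (-(3 * (d : ℝ) / 4) - 1 / 2) := by
      rw [← Real.rpow_natCast, ← Real.rpow_add hp0]
      congr 1
      ring
    rw [hexp]
    ring
  · rw [Set.indicator_of_notMem hX, Set.indicator_of_notMem (by exact fun h => hX (hiff.2 h)),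
      mul_zero, mul_zero]

omit [MeasurableSpace 𝕜] [BorelSpace 𝕜] in
theorem re_det_self_mul_conjTranspose (G : Matrix (Fin 2) (Fin 2) 𝕜) :
    ‖G.det‖ ^ 2 = RCLike.re (G * Gᴴ).det := by
  have := det_mul_mul_conjTranspose G 1
  rw [mul_one, Matrix.det_one, mul_one] at this
  rw [this, RCLike.ofReal_re]

/-- Diagonalizing $Y=U\operatorname{diag}(\mu)U^*$ diagonalizes $D_1$ and $D_2$ simultaneously by
congruence with $SU$. The factors $G,H$ then differ by a diagonal matrix only, as the factorized
integral demands. -/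
theorem lintegral_densityBelow_congr {S : Matrix (Fin 2) (Fin 2) 𝕜} (hS : S.PosDef)
    (ht : (S * S).trace = 1) {r : ℝ} (hr : 0 < r) (hr1 : r ≤ 1) {Y : Matrix (Fin 2) (Fin 2) 𝕜}
    (hY : Y.IsHermitian) (h1 : (1 - Y).PosDef) (h2 : (1 + Y).PosDef) :
    ∫⁻ C : Fin 2 → Fin 2 → 𝕜, densityBelow r (blockState (S * ((2 : ℝ)⁻¹ • (1 - Y)) * Sᴴ)
        (S * ((2 : ℝ)⁻¹ • (1 + Y)) * Sᴴ) (Matrix.of C)) =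
      ENNReal.ofReal (2 ^ (3 * Module.finrank ℝ 𝕜) *
        ((RCLike.re S.det) ^ 4 * RCLike.re (1 - Y ^ 2).det / 16) ^
          ((Module.finrank ℝ 𝕜 : ℝ) / 4 - 1 / 2)) *
        etaBelow 𝕜 r (singularValueRatio (cfc (fun x : ℝ => √((1 - x) / (1 + x))) Y)) := by
  obtain ⟨U, hU, μ, hle, hYU, hf⟩ := exists_unitary_eq_diagonal_sorted hY
  have hUU : Uᴴ * U = 1 := (Unitary.mem_iff.1 hU).1
  have hUU' : U * Uᴴ = 1 := (Unitary.mem_iff.1 hU).2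
  have hm : 1 - Y = U * Matrix.diagonal (fun i => ((1 - μ i : ℝ) : 𝕜)) * Uᴴ := by
    rw [← smul_one_sub_unitary_conj hU, one_smul, ← hYU]
  have hp : 1 + Y = U * Matrix.diagonal (fun i => ((1 + μ i : ℝ) : 𝕜)) * Uᴴ := by
    rw [← one_add_unitary_conj hU, ← hYU]
  have hm0 : ∀ i, 0 < 1 - μ i := by
    rw [← posDef_unitary_conj_diagonal (𝕜 := 𝕜) hU, ← hm]
    exact h1
  have hp0 : ∀ i, 0 < 1 + μ i := by
    rw [← posDef_unitary_conj_diagonal (𝕜 := 𝕜) hU, ← hp]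
    exact h2
  -- $a$ is the root of the spectrum of $(I-Y)/2$. The product $al$ is the root of that of
  -- $(I+Y)/2$, so $G^{-1}H=\operatorname{diag}(l)=l_0\operatorname{diag}(1,l_1/l_0)$.
  set a : Fin 2 → ℝ := fun i => √((1 - μ i) / 2) with ha
  set l : Fin 2 → ℝ := fun i => √((1 + μ i) / (1 - μ i)) with hl
  have hl0 : ∀ i, 0 < l i := fun i => Real.sqrt_pos.2 (div_pos (hp0 i) (hm0 i))
  have ha2 : ∀ i, a i * a i = 2⁻¹ * (1 - μ i) := fun i => by
    rw [ha, Real.mul_self_sqrt (by have := hm0 i; positivity)]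
    ring
  have hal2 : ∀ i, a i * l i * (a i * l i) = 2⁻¹ * (1 + μ i) := fun i => by
    have h3 : l i * l i = (1 + μ i) / (1 - μ i) := Real.mul_self_sqrt (div_pos (hp0 i) (hm0 i)).le
    have := (hm0 i).ne'
    calc a i * l i * (a i * l i) = (a i * a i) * (l i * l i) := by ring
      _ = _ := by rw [ha2, h3]; field_simp
  have hsand : ∀ b : Fin 2 → ℝ,
      S * U * Matrix.diagonal (fun i => (b i : 𝕜)) *
        (S * U * Matrix.diagonal (fun i => (b i : 𝕜)))ᴴ =
      S * (U * Matrix.diagonal (fun i => ((b i * b i : ℝ) : 𝕜)) * Uᴴ) * Sᴴ := by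
    intro b
    have hd : Matrix.diagonal (fun i => ((b i * b i : ℝ) : 𝕜)) =
        Matrix.diagonal (fun i => (b i : 𝕜)) * (Matrix.diagonal (fun i => (b i : 𝕜)))ᴴ := by
      rw [Matrix.diagonal_conjTranspose, Matrix.diagonal_mul_diagonal]
      congr 1
      ext i
      simp
    rw [hd, Matrix.conjTranspose_mul, Matrix.conjTranspose_mul]
    simp only [mul_assoc]
  have hhalf : ∀ b : Fin 2 → ℝ, (2 : ℝ)⁻¹ • (U * Matrix.diagonal (fun i => (b i : 𝕜)) * Uᴴ) =
      U * Matrix.diagonal (fun i => ((2⁻¹ * b i : ℝ) : 𝕜)) * Uᴴ := by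
    intro b
    have hd : Matrix.diagonal (fun i => ((2⁻¹ * b i : ℝ) : 𝕜)) =
        (2 : ℝ)⁻¹ • Matrix.diagonal (fun i => (b i : 𝕜)) := by
      rw [← Matrix.diagonal_smul]
      congr 1
      ext i
      simp [RCLike.real_smul_eq_coe_mul]
    rw [hd, Matrix.mul_smul, Matrix.smul_mul]
  set G := S * U * Matrix.diagonal (fun i => (a i : 𝕜)) with hGdef
  set H := S * U * Matrix.diagonal (fun i => ((a i * l i : ℝ) : 𝕜)) with hHdef
  have hD1 : S * ((2 : ℝ)⁻¹ • (1 - Y)) * Sᴴ = G * Gᴴ := by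
    rw [hGdef, hsand, hm, hhalf]
    simp only [ha2]
  have hD2 : S * ((2 : ℝ)⁻¹ • (1 + Y)) * Sᴴ = H * Hᴴ := by
    rw [hHdef, hsand, hp, hhalf]
    simp only [hal2]
  have hGu : IsUnit G := by
    apply isUnit_of_mul_conjTranspose
    rw [← hD1]
    exact (Matrix.IsUnit.posDef_star_right_conjugate_iff hS.isUnit).2 (h1.smul (by norm_num))
  have hH : H = G * l 0 • scaleMatrix 𝕜 (l 1 / l 0) := by
    rw [hHdef, hGdef, Matrix.mul_assoc _ _ (l 0 • _)]
    congr 1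
    rw [scaleMatrix, ← Matrix.diagonal_smul, Matrix.diagonal_mul_diagonal]
    congr 1
    ext i
    fin_cases i
    · simp [RCLike.real_smul_eq_coe_mul]
    · have := (hl0 0).ne'
      have h' : ((l 0 : ℝ) : 𝕜) ≠ 0 := by exact_mod_cast this
      simp only [Fin.mk_one, Matrix.cons_val_one, Pi.smul_apply, Matrix.cons_val_fin_one,
        RCLike.real_smul_eq_coe_mul, RCLike.ofReal_mul, RCLike.ofReal_div]
      field_simp
  have hsum : S * ((2 : ℝ)⁻¹ • (1 - Y)) * Sᴴ + S * ((2 : ℝ)⁻¹ • (1 + Y)) * Sᴴ = S * S := by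
    rw [← add_mul, ← mul_add, ← smul_add, sub_add_add_cancel, ← two_smul ℝ, smul_smul,
      inv_mul_cancel₀ two_ne_zero, one_smul, mul_one, hS.1.eq]
  have htr : (G * Gᴴ + H * Hᴴ).trace = 1 := by rw [← hD1, ← hD2, hsum, ht]
  -- The matrix $\sqrt{(I-Y)/(I+Y)}$ has eigenvalues $1/l_i$. The ordering $\mu_1\le\mu_0$ makes
  -- $1/l_0$ the smaller one, so the ratio is $l_1/l_0\le1$.
  have hratio : singularValueRatio (cfc (fun x : ℝ => √((1 - x) / (1 + x))) Y) = l 1 / l 0 := by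
    have hz : ∀ i, √((1 - μ i) / (1 + μ i)) = (l i)⁻¹ := fun i => by
      rw [hl, ← Real.sqrt_inv, inv_div]
    have hll : l 1 ≤ l 0 := by
      refine Real.sqrt_le_sqrt ?_
      rw [div_le_div_iff₀ (hm0 1) (hm0 0)]
      nlinarith
    rw [hf]
    simp only [hz]
    rw [singularValueRatio_unitary_conj_diagonal hU (z := fun i => (l i)⁻¹) (inv_pos.2 (hl0 0))
      (inv_anti₀ (hl0 1) hll)]
    have h3 := (hl0 0).ne'
    have h4 := (hl0 1).ne'
    field_simp
  have hSdet : ‖S.det‖ ^ 2 = RCLike.re S.det ^ 2 := by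
    have := RCLike.pos_iff.1 hS.det_pos
    rw [RCLike.norm_sq_eq_def, this.2]
    ring
  have hdetU : ∀ b : Fin 2 → ℝ, RCLike.re (S * (U * Matrix.diagonal (fun i => (b i : 𝕜)) * Uᴴ) *
      Sᴴ).det = RCLike.re S.det ^ 2 * (b 0 * b 1) := by
    intro b
    rw [det_mul_mul_conjTranspose, hSdet, Matrix.det_mul_comm, ← mul_assoc, hUU, one_mul,
      Matrix.det_diagonal, Fin.prod_univ_two, ← RCLike.ofReal_mul, ← RCLike.ofReal_mul,
      RCLike.ofReal_re]
  have hY2 : RCLike.re (1 - Y ^ 2).det = (1 - μ 0 ^ 2) * (1 - μ 1 ^ 2) := by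
    have : 1 - Y ^ 2 = (1 - Y) * (1 + Y) := by noncomm_ring
    rw [this, hm, hp, Matrix.det_mul, Matrix.det_mul_comm, ← mul_assoc, hUU, one_mul,
      Matrix.det_mul_comm (_ * _), ← mul_assoc, hUU, one_mul, Matrix.det_diagonal,
      Matrix.det_diagonal, Fin.prod_univ_two, Fin.prod_univ_two, ← RCLike.ofReal_mul,
      ← RCLike.ofReal_mul, ← RCLike.ofReal_mul, RCLike.ofReal_re]
    ring
  have hpp : ‖G.det‖ ^ 2 * ‖H.det‖ ^ 2 =
      RCLike.re S.det ^ 4 * RCLike.re (1 - Y ^ 2).det / 16 := by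
    rw [re_det_self_mul_conjTranspose, re_det_self_mul_conjTranspose, hGdef, hHdef, hsand, hsand,
      hdetU, hdetU, ha2, ha2, hal2, hal2, hY2]
    ring
  rw [hD1, hD2, hratio, ← hpp]
  exact lintegral_densityBelow_factorized hGu (hl0 0) (div_pos (hl0 1) (hl0 0)) hr hr1 hH htr

end InnerIntegral

/-! ### Conditioned and total volumes. -/

section ConditionedVolume

variable {𝕜 : Type*} [RCLike 𝕜]

theorem continuous_herm {α : Type*} [TopologicalSpace α] {a c : α → ℝ} {b : α → 𝕜}
    (ha : Continuous a) (hc : Continuous c) (hb : Continuous b) :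
    Continuous fun x => herm (a x) (c x) (b x) := by
  refine continuous_matrix fun i j => ?_
  fin_cases i <;> fin_cases j
  · exact RCLike.continuous_ofReal.comp ha
  · exact hb
  · exact continuous_star.comp hb
  · exact RCLike.continuous_ofReal.comp hc

theorem herm_one : herm 1 1 (0 : 𝕜) = 1 := by
  ext i j
  fin_cases i <;> fin_cases j <;> simp [herm]

variable [MeasurableSpace 𝕜] [BorelSpace 𝕜]

theorem conditionedVolume_eq_lintegral (D : Matrix (Fin 2) (Fin 2) 𝕜) {r : ℝ} (hr : 0 < r) :
    conditionedVolume Real.sqrt (separableStatesBelow 𝕜 r) D =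
      ∫⁻ x : (ℝ × ℝ × 𝕜) × (Fin 2 → Fin 2 → 𝕜), densityBelow r
        (blockState (herm x.1.1 x.1.2.1 x.1.2.2) (D - herm x.1.1 x.1.2.1 x.1.2.2)
          (Matrix.of x.2)) := by
  have h1 : Continuous fun x : (ℝ × ℝ × 𝕜) × (Fin 2 → Fin 2 → 𝕜) =>
      herm x.1.1 x.1.2.1 x.1.2.2 := continuous_herm (by fun_prop) (by fun_prop) (by fun_prop)
  have hC : Continuous fun x : (ℝ × ℝ × 𝕜) × (Fin 2 → Fin 2 → 𝕜) =>
      (Matrix.of x.2 : Matrix (Fin 2) (Fin 2) 𝕜) := continuous_snd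
  have hset : {x : (ℝ × ℝ × 𝕜) × (Fin 2 → Fin 2 → 𝕜) |
      blockState (herm x.1.1 x.1.2.1 x.1.2.2) (D - herm x.1.1 x.1.2.1 x.1.2.2) (Matrix.of x.2) ∈
        conditioned (separableStatesBelow 𝕜 r) D} =
      {x | blockState (herm x.1.1 x.1.2.1 x.1.2.2) (D - herm x.1.1 x.1.2.1 x.1.2.2)
        (Matrix.of x.2) ∈ separableStatesBelow 𝕜 r} := by
    ext x
    simp [conditioned, partialTrace, blockState]
  rw [conditionedVolume]
  simp only
  have h2 : Continuous fun x : (ℝ × ℝ × 𝕜) × (Fin 2 → Fin 2 → 𝕜) =>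
      D - herm x.1.1 x.1.2.1 x.1.2.2 := continuous_const.sub h1
  rw [hset, ← lintegral_indicator (measurableSet_separableStatesBelow h1 h2 hC hr)]
  rfl

theorem lintegral_densityBelow_of_not {D₁ D₂ : Matrix (Fin 2) (Fin 2) 𝕜} {r : ℝ}
    (h : ¬(D₁.PosDef ∧ D₂.PosDef)) :
    ∫⁻ C : Fin 2 → Fin 2 → 𝕜, densityBelow r (blockState D₁ D₂ (Matrix.of C)) = 0 := by
  have : ∀ C : Fin 2 → Fin 2 → 𝕜, densityBelow r (blockState D₁ D₂ (Matrix.of C)) = 0 :=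
    fun C => Set.indicator_of_notMem (fun hC => h (posDef_of_blockState hC.1.2.1)) _
  simp [this]

/-- The affine substitution $D_1=S\frac{I-Y}2S$ is a scaling by $-1/2$ on a space of dimension
$2+d$, a translation by $I/2$ and the congruence by $S$. Its Jacobian is $(\det S/2)^{2+d}$. -/
theorem lintegral_herm_eq {S : Matrix (Fin 2) (Fin 2) 𝕜} (hS : S.PosDef)
    (g : Matrix (Fin 2) (Fin 2) 𝕜 → ℝ≥0∞) :
    ∫⁻ y : ℝ × ℝ × 𝕜, g (herm y.1 y.2.1 y.2.2) =
      ENNReal.ofReal ((RCLike.re S.det / 2) ^ (2 + Module.finrank ℝ 𝕜)) *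
        ∫⁻ y : ℝ × ℝ × 𝕜, g (S * ((2 : ℝ)⁻¹ • (1 - herm y.1 y.2.1 y.2.2)) * Sᴴ) := by
  have hs : 0 < RCLike.re S.det := (RCLike.pos_iff.1 hS.det_pos).1
  have hdet := det_hermCongr hS.1
  have hne : LinearMap.det (hermCongr S) ≠ 0 := by
    rw [hdet]
    positivity
  have hscale : LinearMap.det ((-(2 : ℝ)⁻¹) • (LinearMap.id : (ℝ × ℝ × 𝕜) →ₗ[ℝ] (ℝ × ℝ × 𝕜))) =
      (-(2 : ℝ)⁻¹) ^ (2 + Module.finrank ℝ 𝕜) := by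
    rw [LinearMap.det_smul, LinearMap.det_id, mul_one, Module.finrank_prod, Module.finrank_prod,
      Module.finrank_self]
    congr 1
    ring
  have hne' : LinearMap.det
      ((-(2 : ℝ)⁻¹) • (LinearMap.id : (ℝ × ℝ × 𝕜) →ₗ[ℝ] (ℝ × ℝ × 𝕜))) ≠ 0 := by
    rw [hscale]
    positivity
  rw [lintegral_eq_abs_det_mul_lintegral_comp volume hne, hdet,
    ← lintegral_add_left_eq_self _ ((2 : ℝ)⁻¹ • ((1, 1, 0) : ℝ × ℝ × 𝕜)),
    lintegral_eq_abs_det_mul_lintegral_comp volume hne', hscale, ← mul_assoc,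
    ← ENNReal.ofReal_mul (abs_nonneg _), abs_pow, abs_pow, abs_neg, ← mul_pow, abs_of_pos hs,
    abs_of_pos (by norm_num : (0 : ℝ) < 2⁻¹), ← div_eq_mul_inv]
  congr 1
  refine lintegral_congr fun y => ?_
  rw [herm_hermCongr]
  congr 3
  have hsub : 1 - herm y.1 y.2.1 y.2.2 = herm 1 1 0 + (-1 : ℝ) • herm y.1 y.2.1 y.2.2 := by
    rw [herm_one, neg_one_smul, sub_eq_add_neg]
  rw [hsub, herm_smul, herm_add, herm_smul]
  simp only [Prod.fst_add, Prod.snd_add, Prod.smul_fst, Prod.smul_snd, LinearMap.smul_apply,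
    LinearMap.id_apply, smul_eq_mul, smul_add, smul_smul]
  congr 1
  · ring
  · ring
  · simp

/-- The set of coordinates of the operator interval `-I < Y < I`. -/
def intervalCoords (𝕜 : Type*) [RCLike 𝕜] : Set (ℝ × ℝ × 𝕜) :=
  {y | (1 - herm y.1 y.2.1 y.2.2).PosDef ∧ (1 + herm y.1 y.2.1 y.2.2).PosDef}

theorem measurableSet_intervalCoords : MeasurableSet (intervalCoords 𝕜) := by
  have h : Continuous fun y : ℝ × ℝ × 𝕜 => herm y.1 y.2.1 y.2.2 :=
    continuous_herm (by fun_prop) (by fun_prop) (by fun_prop)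
  exact (measurableSet_posDef (continuous_const.sub h)).inter
    (measurableSet_posDef (continuous_const.add h))

/-- Here $s=\det S$ and $q=\det(I-Y^2)$. The powers of $s/2$ combine to $2d$, so $\det D=s^2$ enters
with exponent $d$. The stated exponent $\frac52d-\frac{d^2}2-1$ equals $d$ exactly when $d$ is 1 or
2. -/
theorem jacobian_identity {d : ℕ} (hd : d = 1 ∨ d = 2) {s q : ℝ} (hs : 0 < s) (hq : 0 < q) :
    (s / 2) ^ (2 + d) * (2 ^ (3 * d) * (s ^ 4 * q / 16) ^ ((d : ℝ) / 4 - 1 / 2)) =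
      2 ^ d * (s ^ 2) ^ (5 / 2 * (d : ℝ) - (d : ℝ) ^ 2 / 2 - 1) * q ^ (((d : ℝ) - 2) / 4) := by
  have h16 : s ^ 4 * q / 16 = (s / 2) ^ 4 * q := by ring
  have hk : (s / 2) ^ (2 + d) * ((s / 2) ^ 4) ^ ((d : ℝ) / 4 - 1 / 2) = (s / 2) ^ (2 * d) := by
    have h2 : 0 < s / 2 := by positivity
    rw [← Real.rpow_natCast _ 4, ← Real.rpow_mul h2.le, ← Real.rpow_natCast, ← Real.rpow_natCast,
      ← Real.rpow_add h2]
    congr 1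
    push_cast
    ring
  have he : (s ^ 2) ^ (5 / 2 * (d : ℝ) - (d : ℝ) ^ 2 / 2 - 1) = s ^ (2 * d) := by
    rw [pow_mul, ← Real.rpow_natCast (s ^ 2) d]
    congr 1
    rcases hd with rfl | rfl <;> norm_num
  have hq' : (d : ℝ) / 4 - 1 / 2 = ((d : ℝ) - 2) / 4 := by ring
  rw [h16, Real.mul_rpow (by positivity) hq.le, he]
  calc _ = 2 ^ (3 * d) * ((s / 2) ^ (2 + d) * ((s / 2) ^ 4) ^ ((d : ℝ) / 4 - 1 / 2)) *
        q ^ ((d : ℝ) / 4 - 1 / 2) := by ring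
    _ = _ := by
      rw [hk, hq', div_pow, pow_mul 2 3, pow_mul 2 2]
      have : (2 ^ 3 : ℝ) ^ d = 2 ^ d * (2 ^ 2) ^ d := by rw [← mul_pow]; norm_num
      rw [this]
      field_simp

theorem conditionedVolume_separableStatesBelow {D : Matrix (Fin 2) (Fin 2) 𝕜}
    (hD : D ∈ densityMatrices (Fin 2) 𝕜) {r : ℝ} (hr : 0 < r) (hr1 : r ≤ 1) :
    conditionedVolume Real.sqrt (separableStatesBelow 𝕜 r) D =
      ENNReal.ofReal (2 ^ Module.finrank ℝ 𝕜 * (RCLike.re D.det) ^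
        (5 / 2 * (Module.finrank ℝ 𝕜 : ℝ) - (Module.finrank ℝ 𝕜 : ℝ) ^ 2 / 2 - 1)) *
        operatorIntervalIntegral 𝕜 (etaBelow 𝕜 r) := by
  obtain ⟨S, hS, rfl⟩ := exists_posDef_mul_self_eq hD.1
  have ht : (S * S).trace = 1 := hD.2
  have hSp := RCLike.pos_iff.1 hS.det_pos
  have hs : 0 < RCLike.re S.det := hSp.1
  have hdetD : RCLike.re (S * S).det = RCLike.re S.det ^ 2 := by
    rw [Matrix.det_mul, RCLike.mul_re, hSp.2]
    ring
  have h1 : Continuous fun x : (ℝ × ℝ × 𝕜) × (Fin 2 → Fin 2 → 𝕜) =>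
      herm x.1.1 x.1.2.1 x.1.2.2 := continuous_herm (by fun_prop) (by fun_prop) (by fun_prop)
  have hC : Continuous fun x : (ℝ × ℝ × 𝕜) × (Fin 2 → Fin 2 → 𝕜) =>
      (Matrix.of x.2 : Matrix (Fin 2) (Fin 2) 𝕜) := continuous_snd
  have hmeas := measurable_densityBelow h1 (continuous_const.sub h1) hC hr (D₂ := fun x =>
    S * S - herm x.1.1 x.1.2.1 x.1.2.2)
  rw [conditionedVolume_eq_lintegral _ hr, Measure.volume_eq_prod,
    lintegral_prod _ hmeas.aemeasurable,
    lintegral_herm_eq hS fun D₁ => ∫⁻ C : Fin 2 → Fin 2 → 𝕜,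
      densityBelow r (blockState D₁ (S * S - D₁) (Matrix.of C)),
    operatorIntervalIntegral]
  change _ = _ * ∫⁻ y in intervalCoords 𝕜, _
  rw [← lintegral_indicator measurableSet_intervalCoords,
    ← lintegral_const_mul' _ _ ENNReal.ofReal_ne_top,
    ← lintegral_const_mul' _ _ ENNReal.ofReal_ne_top]
  refine lintegral_congr fun y => ?_
  set Y := herm y.1 y.2.1 y.2.2 with hY
  have hYh : Y.IsHermitian := herm_isHermitian _ _ _
  have hD2 : S * S - S * ((2 : ℝ)⁻¹ • (1 - Y)) * Sᴴ = S * ((2 : ℝ)⁻¹ • (1 + Y)) * Sᴴ := by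
    rw [sub_eq_iff_eq_add', ← add_mul, ← mul_add, ← smul_add, sub_add_add_cancel, ← two_smul ℝ,
      smul_smul, inv_mul_cancel₀ two_ne_zero, one_smul, mul_one, hS.1.eq]
  rw [hD2]
  have hpd : ∀ A : Matrix (Fin 2) (Fin 2) 𝕜,
      (S * ((2 : ℝ)⁻¹ • A) * Sᴴ).PosDef ↔ A.PosDef := by
    intro A
    rw [← Matrix.star_eq_conjTranspose,
      Matrix.IsUnit.posDef_star_right_conjugate_iff hS.isUnit]
    refine ⟨fun h => ?_, fun h => h.smul (by norm_num)⟩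
    have := h.smul (show (0 : ℝ) < 2 by norm_num)
    rwa [smul_smul, mul_inv_cancel₀ two_ne_zero, one_smul] at this
  by_cases hy : y ∈ intervalCoords 𝕜
  · have hq : 0 < RCLike.re (1 - Y ^ 2).det := by
      have h3 : 1 - Y ^ 2 = (1 - Y) * (1 + Y) := by noncomm_ring
      have h4 := RCLike.pos_iff.1 hy.1.det_pos
      have h5 := RCLike.pos_iff.1 hy.2.det_pos
      rw [← hY] at h4 h5
      rw [h3, Matrix.det_mul, RCLike.mul_re, h4.2, zero_mul, sub_zero]
      exact mul_pos h4.1 h5.1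
    rw [Set.indicator_of_mem hy, lintegral_densityBelow_congr hS ht hr hr1 hYh hy.1 hy.2,
      ← mul_assoc, ← mul_assoc, ← ENNReal.ofReal_mul (by positivity),
      ← ENNReal.ofReal_mul (by rw [hdetD]; positivity), hdetD,
      jacobian_identity (finrank_real_eq_one_or_two 𝕜) hs hq]
  · rw [Set.indicator_of_notMem hy, lintegral_densityBelow_of_not (by rw [hpd, hpd]; exact hy),
      mul_zero, mul_zero]

theorem stateVolume_eq_lintegral {r : ℝ} (hr : 0 < r) :
    stateVolume Real.sqrt (separableStatesBelow 𝕜 r) =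
      ∫⁻ x : (ℝ × ℝ × 𝕜) × (ℝ × 𝕜) × (Fin 2 → Fin 2 → 𝕜), densityBelow r
        (blockState (herm x.1.1 x.1.2.1 x.1.2.2)
          (herm x.2.1.1 (1 - x.1.1 - x.1.2.1 - x.2.1.1) x.2.1.2) (Matrix.of x.2.2)) := by
  have h1 : Continuous fun x : (ℝ × ℝ × 𝕜) × (ℝ × 𝕜) × (Fin 2 → Fin 2 → 𝕜) =>
      herm x.1.1 x.1.2.1 x.1.2.2 := continuous_herm (by fun_prop) (by fun_prop) (by fun_prop)
  have h2 : Continuous fun x : (ℝ × ℝ × 𝕜) × (ℝ × 𝕜) × (Fin 2 → Fin 2 → 𝕜) =>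
      herm x.2.1.1 (1 - x.1.1 - x.1.2.1 - x.2.1.1) x.2.1.2 :=
    continuous_herm (by fun_prop) (by fun_prop) (by fun_prop)
  have hC : Continuous fun x : (ℝ × ℝ × 𝕜) × (ℝ × 𝕜) × (Fin 2 → Fin 2 → 𝕜) =>
      (Matrix.of x.2.2 : Matrix (Fin 2) (Fin 2) 𝕜) := continuous_snd.comp continuous_snd
  rw [stateVolume]
  simp only
  rw [← lintegral_indicator (measurableSet_separableStatesBelow h1 h2 hC hr)]
  rfl

/-- For fixed $D_1$, passing from $D_2$ to $D=D_1+D_2$ is a translation of the coordinates of $D_2$,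
so the measure is preserved. Tonelli then exchanges $D_1$ and $D$. Parameters $D$ that are not
states contribute nothing, since $D_1,D_2>0$ forces $D>0$. -/
theorem stateVolume_separableStatesBelow {r : ℝ} (hr : 0 < r) :
    stateVolume Real.sqrt (separableStatesBelow 𝕜 r) =
      baseIntegral (conditionedVolume Real.sqrt (separableStatesBelow 𝕜 r)) := by
  have hz : Continuous fun z : ℝ × 𝕜 => herm z.1 (1 - z.1) z.2 :=
    continuous_herm (by fun_prop) (by fun_prop) (by fun_prop)
  have hzset : MeasurableSet {z : ℝ × 𝕜 | herm z.1 (1 - z.1) z.2 ∈ densityMatrices (Fin 2) 𝕜} :=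
    (measurableSet_posDef hz).inter (isClosed_eq hz.matrix_trace continuous_const).measurableSet
  let F : (ℝ × ℝ × 𝕜) × (ℝ × 𝕜) × (Fin 2 → Fin 2 → 𝕜) → ℝ≥0∞ := fun x =>
    densityBelow r (blockState (herm x.1.1 x.1.2.1 x.1.2.2)
      (herm (x.2.1.1 - x.1.1) (1 - x.2.1.1 - x.1.2.1) (x.2.1.2 - x.1.2.2)) (Matrix.of x.2.2))
  have hC : Continuous fun x : (ℝ × ℝ × 𝕜) × (ℝ × 𝕜) × (Fin 2 → Fin 2 → 𝕜) =>
      (Matrix.of x.2.2 : Matrix (Fin 2) (Fin 2) 𝕜) := continuous_snd.comp continuous_snd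
  have hF : Measurable F := measurable_densityBelow
    (continuous_herm (by fun_prop) (by fun_prop) (by fun_prop))
    (continuous_herm (by fun_prop) (by fun_prop) (by fun_prop)) hC hr
  have hbase : baseIntegral (conditionedVolume Real.sqrt (separableStatesBelow 𝕜 r)) =
      ∫⁻ z : ℝ × 𝕜, ∫⁻ y : ℝ × ℝ × 𝕜, ∫⁻ C : Fin 2 → Fin 2 → 𝕜, F (y, z, C) := by
    rw [baseIntegral, ← lintegral_indicator hzset]
    refine lintegral_congr fun z => ?_
    have hsub : ∀ y : ℝ × ℝ × 𝕜, herm z.1 (1 - z.1) z.2 - herm y.1 y.2.1 y.2.2 =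
        herm (z.1 - y.1) (1 - z.1 - y.2.1) (z.2 - y.2.2) := by
      intro y
      rw [sub_eq_iff_eq_add, herm_add]
      simp
    by_cases hzm : herm z.1 (1 - z.1) z.2 ∈ densityMatrices (Fin 2) 𝕜
    · rw [Set.indicator_of_mem (by exact hzm), conditionedVolume_eq_lintegral _ hr,
        Measure.volume_eq_prod, lintegral_prod]
      · simp only [hsub]
        rfl
      · simp only [hsub]
        exact (hF.comp (show Measurable fun x : (ℝ × ℝ × 𝕜) × (Fin 2 → Fin 2 → 𝕜) =>
          (x.1, z, x.2) by fun_prop)).aemeasurable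
    · rw [Set.indicator_of_notMem (by exact hzm)]
      have : ∀ y : ℝ × ℝ × 𝕜, ∫⁻ C : Fin 2 → Fin 2 → 𝕜, F (y, z, C) = 0 := by
        intro y
        refine lintegral_densityBelow_of_not (D₁ := herm y.1 y.2.1 y.2.2)
          (D₂ := herm (z.1 - y.1) (1 - z.1 - y.2.1) (z.2 - y.2.2)) fun h => hzm ⟨?_, ?_⟩
        · have h3 := h.1.add h.2
          simp only [← hsub, add_sub_cancel] at h3
          exact h3
        · simp [herm, Matrix.trace_fin_two]
      simp [this]
  have hinner : Measurable fun p : (ℝ × 𝕜) × (ℝ × ℝ × 𝕜) =>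
      ∫⁻ C : Fin 2 → Fin 2 → 𝕜, F (p.2, p.1, C) :=
    Measurable.lintegral_prod_right' (hF.comp
      (show Measurable fun q : ((ℝ × 𝕜) × (ℝ × ℝ × 𝕜)) × (Fin 2 → Fin 2 → 𝕜) =>
        (q.1.2, q.1.1, q.2) by fun_prop))
  have hshift : stateVolume Real.sqrt (separableStatesBelow 𝕜 r) =
      ∫⁻ y : ℝ × ℝ × 𝕜, ∫⁻ z : ℝ × 𝕜, ∫⁻ C : Fin 2 → Fin 2 → 𝕜, F (y, z, C) := by
    rw [stateVolume_eq_lintegral hr]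
    -- In `F` the middle argument is the coordinate of $D$. The last entry of $D_2$ matches because
    -- both descriptions impose total trace one.
    have hEq : ∀ x : (ℝ × ℝ × 𝕜) × (ℝ × 𝕜) × (Fin 2 → Fin 2 → 𝕜), densityBelow r
        (blockState (herm x.1.1 x.1.2.1 x.1.2.2)
          (herm x.2.1.1 (1 - x.1.1 - x.1.2.1 - x.2.1.1) x.2.1.2) (Matrix.of x.2.2)) =
        F (x.1, (x.1.1, x.1.2.2) + x.2.1, x.2.2) := by
      intro x
      simp only [F, Prod.fst_add, Prod.snd_add, add_sub_cancel_left]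
      congr 3
      ring
    simp only [hEq]
    have hm : Measurable fun x : (ℝ × ℝ × 𝕜) × (ℝ × 𝕜) × (Fin 2 → Fin 2 → 𝕜) =>
        F (x.1, (x.1.1, x.1.2.2) + x.2.1, x.2.2) := hF.comp (by fun_prop)
    rw [Measure.volume_eq_prod, lintegral_prod _ hm.aemeasurable]
    refine lintegral_congr fun y => ?_
    refine (lintegral_prod (μ := (volume : Measure (ℝ × 𝕜)))
      (ν := (volume : Measure (Fin 2 → Fin 2 → 𝕜)))
      (fun q => F (y, (y.1, y.2.2) + q.1, q.2))
      (hm.comp measurable_prodMk_left).aemeasurable).trans ?_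
    exact lintegral_add_left_eq_self
      (fun w : ℝ × 𝕜 => ∫⁻ C : Fin 2 → Fin 2 → 𝕜, F (y, w, C)) (y.1, y.2.2)
  rw [hbase, hshift, lintegral_lintegral_swap]
  exact (hinner.comp measurable_swap).aemeasurable

end ConditionedVolume

/-! ### Divergence of the integrals for $r=1$. -/

section Divergence

open scoped Pointwise
open Filter Topology

/-- By scaling, the shell $t\le N<1$ of the cone has at least the fraction $1-t$ of the measure of
$W$. The bound $(1-t^2)^{-1}$ then gives it integral at least $\frac12\mu(W)$. A finite integral
would force these integrals to zero as $t\to1$, because the shells decrease to the empty set. -/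
theorem lintegral_eq_top_of_homogeneous {E : Type*} [NormedAddCommGroup E] [NormedSpace ℝ E]
    [MeasurableSpace E] [BorelSpace E] [FiniteDimensional ℝ E] [Nontrivial E] (μ : Measure E)
    [μ.IsAddHaarMeasure] {N : E → ℝ} (hN : Continuous N)
    (hNs : ∀ (t : ℝ) X, 0 < t → N (t • X) = t * N X)
    {K : Set E} (hKm : MeasurableSet K) (hK : ∀ (t : ℝ) X, 0 < t → (t • X ∈ K ↔ X ∈ K))
    (hpos : μ (K ∩ {X | N X < 1}) ≠ 0) {g : E → ℝ≥0∞}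
    (hg : ∀ t : ℝ, 0 ≤ t → t < 1 → ∀ X ∈ K, t ≤ N X → N X < 1 →
      ENNReal.ofReal (1 - t ^ 2)⁻¹ ≤ g X) (hg1 : ∀ X ∈ K, N X < 1 → 1 ≤ g X) :
    ∫⁻ X in K ∩ {X | N X < 1}, g X ∂μ = ∞ := by
  by_contra hfin
  set W := K ∩ {X | N X < 1} with hW
  have hWm : MeasurableSet W := hKm.inter (isOpen_lt hN continuous_const).measurableSet
  have hμ : μ W ≠ ∞ := by
    refine ne_top_of_le_ne_top hfin ?_
    calc μ W = ∫⁻ _ in W, 1 ∂μ := by simp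
      _ ≤ _ := setLIntegral_mono' hWm fun X hX => hg1 X hX.1 hX.2
  have hlow : ∀ t : ℝ, 0 < t → t < 1 →
      ENNReal.ofReal 2⁻¹ * μ W ≤ ∫⁻ X in {X | t ≤ N X}, g X ∂(μ.restrict W) := by
    intro t ht ht1
    have hm : MeasurableSet {X | t ≤ N X} := (isClosed_le continuous_const hN).measurableSet
    have hsmul : t • W = K ∩ {X | N X < t} := by
      ext X
      rw [Set.mem_smul_set_iff_inv_smul_mem₀ ht.ne']
      have h1 := hK t⁻¹ X (inv_pos.2 ht)
      have h2 := hNs t⁻¹ X (inv_pos.2 ht)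
      simp only [hW, Set.mem_inter_iff, Set.mem_ofPred_eq, h1, h2]
      rw [inv_mul_lt_iff₀ ht, mul_one]
    have hdiff : {X | t ≤ N X} ∩ W = W \ t • W := by
      rw [hsmul]
      ext X
      simp only [hW, Set.mem_inter_iff, Set.mem_ofPred_eq, Set.mem_sdiff, not_and, not_lt]
      tauto
    have hsub : t • W ⊆ W := by
      rw [hsmul]
      exact fun X hX => ⟨hX.1, lt_trans (show N X < t from hX.2) ht1⟩
    have hmeas : ENNReal.ofReal (1 - t) * μ W ≤ μ ({X | t ≤ N X} ∩ W) := by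
      have hn : Module.finrank ℝ E ≠ 0 := Module.finrank_pos.ne'
      have htn : t ^ Module.finrank ℝ E ≤ t := pow_le_of_le_one ht.le ht1.le hn
      rw [hdiff, measure_sdiff hsub (hWm.const_smul₀ t).nullMeasurableSet
        (ne_top_of_le_ne_top hμ (measure_mono hsub)), Measure.addHaar_smul,
        abs_of_pos (by positivity), ENNReal.ofReal_sub _ ht.le, ENNReal.ofReal_one,
        ENNReal.sub_mul fun _ _ => hμ, one_mul]
      gcongr
    calc ENNReal.ofReal 2⁻¹ * μ W
        ≤ ENNReal.ofReal (1 - t ^ 2)⁻¹ * (ENNReal.ofReal (1 - t) * μ W) := by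
          rw [← mul_assoc, ← ENNReal.ofReal_mul (by
            rw [inv_nonneg]
            nlinarith)]
          gcongr
          have h1 : (1 - t ^ 2)⁻¹ * (1 - t) = (1 + t)⁻¹ := by
            have : 1 - t ≠ 0 := by linarith
            have : 1 + t ≠ 0 := by linarith
            rw [show 1 - t ^ 2 = (1 + t) * (1 - t) by ring]
            field_simp
          rw [h1]
          exact inv_anti₀ (by linarith) (by linarith)
      _ ≤ ENNReal.ofReal (1 - t ^ 2)⁻¹ * μ ({X | t ≤ N X} ∩ W) := by gcongr
      _ = ∫⁻ _ in {X | t ≤ N X} ∩ W, ENNReal.ofReal (1 - t ^ 2)⁻¹ ∂μ := by simp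
      _ ≤ ∫⁻ X in {X | t ≤ N X} ∩ W, g X ∂μ :=
          setLIntegral_mono' (hm.inter hWm) fun X hX => hg t ht.le ht1 X hX.2.1 hX.1 hX.2.2
      _ = _ := by rw [Measure.restrict_restrict hm]
  -- The shift by 2 starts the sequence at $1/2$, since the shell bound needs $t>0$.
  let t : ℕ → ℝ := fun k => 1 - 1 / ((k : ℝ) + 2)
  have ht0 : ∀ k, 0 < t k := fun k => by
    have : (0 : ℝ) ≤ k := k.cast_nonneg
    simp only [t]
    rw [sub_pos, div_lt_one (by linarith)]
    linarith
  have ht1 : ∀ k, t k < 1 := fun k => by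
    simp only [t]
    have : (0 : ℝ) < 1 / ((k : ℝ) + 2) := by positivity
    linarith
  have htlim : Tendsto (fun k => t k) atTop (𝓝 1) := by
    have h := tendsto_one_div_add_atTop_nhds_zero_nat (𝕜 := ℝ)
    have h' := (h.comp (tendsto_add_atTop_nat 1)).const_sub 1
    rw [sub_zero] at h'
    refine h'.congr fun k => ?_
    simp only [t, Function.comp_apply]
    push_cast
    ring
  have hanti : Antitone fun k => {X | t k ≤ N X} := by
    intro k l hkl X hX
    refine le_trans ?_ (show t l ≤ N X from hX)
    simp only [t]
    gcongr
  have hfinm : IsFiniteMeasure (μ.restrict W) := ⟨by simpa using hμ.lt_top⟩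
  have hempty : (μ.restrict W) (⋂ k, {X | t k ≤ N X}) = 0 := by
    rw [Measure.restrict_apply' hWm]
    convert! measure_empty (μ := μ)
    refine Set.eq_empty_of_forall_notMem fun X hX => ?_
    have h1 : 1 ≤ N X := le_of_tendsto' htlim fun k => Set.mem_iInter.1 hX.1 k
    exact not_lt.2 h1 hX.2.2
  have hlim : Tendsto ((μ.restrict W) ∘ fun k => {X | t k ≤ N X}) atTop (𝓝 0) := by
    rw [← hempty]
    exact tendsto_measure_iInter_atTop
      (fun k => (isClosed_le continuous_const hN).measurableSet.nullMeasurableSet) hanti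
      ⟨0, measure_ne_top _ _⟩
  have hzero := tendsto_setLIntegral_zero hfin hlim
  have hle := ge_of_tendsto' hzero fun k => hlow (t k) (ht0 k) (ht1 k)
  simp [hpos] at hle

variable {𝕜 : Type*} [RCLike 𝕜]

theorem continuous_opNorm_sandwich (A B : Matrix (Fin 2) (Fin 2) 𝕜) :
    Continuous fun X : Fin 2 → Fin 2 → 𝕜 => opNorm (A * Matrix.of X * B) := by
  have hof : Continuous fun X : Fin 2 → Fin 2 → 𝕜 => (Matrix.of X : Matrix (Fin 2) (Fin 2) 𝕜) :=
    continuous_id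
  exact continuous_opNorm.comp ((continuous_const.matrix_mul hof).matrix_mul continuous_const)

variable [MeasurableSpace 𝕜] [BorelSpace 𝕜]

/-- On the cone $\|V^{-1}XV\|\le\|X\|$ the second norm condition is redundant, and the exponent is
at most $-1$ (it is $-5/4$ or $-2$). The homogeneous divergence criterion therefore applies. -/
theorem eta_eq_top {ε : ℝ} (hε : 0 < ε) (hε1 : ε ≤ 1) : eta 𝕜 ε = ∞ := by
  let V := scaleMatrix 𝕜 ε
  let N : (Fin 2 → Fin 2 → 𝕜) → ℝ := fun X => opNorm (Matrix.of X)
  let N' : (Fin 2 → Fin 2 → 𝕜) → ℝ := fun X => opNorm (V⁻¹ * Matrix.of X * V)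
  have hNc : Continuous N := by simpa using continuous_opNorm_sandwich (1 : Matrix _ _ 𝕜) 1
  have hNc' : Continuous N' := continuous_opNorm_sandwich _ _
  have hNs : ∀ (t : ℝ) X, 0 < t → N (t • X) = t * N X := by
    intro t X ht
    have := opNorm_smul t (Matrix.of X)
    rwa [abs_of_pos ht] at this
  have hNs' : ∀ (t : ℝ) X, 0 < t → N' (t • X) = t * N' X := by
    intro t X ht
    have := opNorm_smul t (V⁻¹ * Matrix.of X * V)
    rw [abs_of_pos ht, ← Matrix.smul_mul, ← Matrix.mul_smul] at this
    exact this
  let K : Set (Fin 2 → Fin 2 → 𝕜) := {X | N' X ≤ N X}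
  have hpos : volume (K ∩ {X | N X < 1}) ≠ 0 := by
    rcases hε1.lt_or_eq with hlt | rfl
    · have hopen : IsOpen ({X | N' X < N X} ∩ {X | N X < 1}) :=
        (isOpen_lt hNc' hNc).inter (isOpen_lt hNc continuous_const)
      have hne : ({X | N' X < N X} ∩ {X | N X < 1}).Nonempty := by
        -- Conjugation by $V$ multiplies this matrix unit by $\varepsilon<1$. A multiple of it
        -- therefore lies in the open part of the cone inside the unit ball, which has positive
        -- measure.
        let X₀ : Fin 2 → Fin 2 → 𝕜 := ![![0, 1], ![0, 0]]
        have h0 : N' X₀ = ε * N X₀ := by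
          have hV : V * (ε • Matrix.of X₀) = Matrix.of X₀ * V := by
            ext i j
            fin_cases i <;> fin_cases j <;>
              simp [V, scaleMatrix, X₀, RCLike.real_smul_eq_coe_mul]
          have hVd : IsUnit V.det :=
            (Matrix.isUnit_iff_isUnit_det _).1 (isUnit_scaleMatrix hε.ne')
          simp only [N', N]
          rw [mul_assoc, ← hV, Matrix.nonsing_inv_mul_cancel_left _ _ hVd, opNorm_smul,
            abs_of_pos hε]
        have h1 : 0 < N X₀ := by
          refine lt_of_le_of_ne (norm_nonneg _) fun h => ?_
          have h2 : ‖Matrix.toEuclideanCLM (𝕜 := 𝕜) (Matrix.of X₀)‖ = 0 := h.symm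
          rw [norm_eq_zero, map_eq_zero_iff _ (EquivLike.injective _)] at h2
          have := congrFun (congrFun h2 0) 1
          simp [X₀] at this
        refine ⟨(2 * N X₀)⁻¹ • X₀, ?_, ?_⟩
        · simp only [Set.mem_ofPred_eq]
          rw [hNs _ _ (by positivity), hNs' _ _ (by positivity), h0]
          have : ε * N X₀ < N X₀ := by nlinarith
          gcongr
        · simp only [Set.mem_ofPred_eq]
          rw [hNs _ _ (by positivity)]
          field_simp
          norm_num
      refine (lt_of_lt_of_le (hopen.measure_pos volume hne) (measure_mono ?_)).ne'
      exact fun X hX => ⟨show N' X ≤ N X from le_of_lt hX.1, hX.2⟩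
    · have hV1 : V = 1 := by
        simp only [V, scaleMatrix, RCLike.ofReal_one]
        ext i j
        fin_cases i <;> fin_cases j <;> simp
      refine (lt_of_lt_of_le ((isOpen_lt hNc continuous_const).measure_pos volume
        ⟨0, show N 0 < 1 by simp [N, opNorm]⟩) (measure_mono ?_)).ne'
      intro X hX
      refine ⟨?_, hX⟩
      simp [K, N, N', hV1]
  have hκ : -(3 * (Module.finrank ℝ 𝕜 : ℝ) / 4) - 1 / 2 ≤ -1 := by
    rcases finrank_real_eq_one_or_two 𝕜 with h | h <;> rw [h] <;> norm_num
  have hφ : ∀ X, N X < 1 → 0 < RCLike.re (1 - Matrix.of X * (Matrix.of X)ᴴ).det := by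
    intro X hX
    have := (opNorm_lt_iff one_pos).1 hX
    rw [one_pow, one_smul] at this
    exact (RCLike.pos_iff.1 this.det_pos).1
  have hg : ∀ t : ℝ, 0 ≤ t → t < 1 → ∀ X ∈ K, t ≤ N X → N X < 1 →
      ENNReal.ofReal (1 - t ^ 2)⁻¹ ≤
        ENNReal.ofReal ((RCLike.re (1 - Matrix.of X * (Matrix.of X)ᴴ).det) ^
          (-(3 * (Module.finrank ℝ 𝕜 : ℝ) / 4) - 1 / 2)) := by
    intro t ht ht1 X _ htX hX
    refine ENNReal.ofReal_le_ofReal ?_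
    have h0 := hφ X hX
    have h1 : RCLike.re (1 - Matrix.of X * (Matrix.of X)ᴴ).det ≤ 1 - t ^ 2 := by
      have h2 := re_det_one_sub_le hX
      have h3 : t ^ 2 ≤ N X ^ 2 := by gcongr
      exact h2.trans (sub_le_sub_left h3 1)
    calc (1 - t ^ 2)⁻¹ ≤ (RCLike.re (1 - Matrix.of X * (Matrix.of X)ᴴ).det)⁻¹ := inv_anti₀ h0 h1
      _ = (RCLike.re (1 - Matrix.of X * (Matrix.of X)ᴴ).det) ^ (-1 : ℝ) := by
          rw [Real.rpow_neg_one]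
      _ ≤ _ := Real.rpow_le_rpow_of_exponent_ge h0 (h1.trans (by nlinarith)) hκ
  have htop := lintegral_eq_top_of_homogeneous volume hNc hNs
    (isClosed_le hNc' hNc).measurableSet
    (fun t X ht => by
      simp only [Set.mem_ofPred_eq, hNs t X ht, hNs' t X ht]
      exact mul_le_mul_iff_right₀ ht) hpos hg (fun X hXK hX => by
      simpa using hg 0 le_rfl one_pos X hXK (norm_nonneg _) hX)
  rw [eta, etaBelow, eq_top_iff, ← htop]
  exact lintegral_mono_set fun X hX => ⟨hX.2, lt_of_le_of_lt hX.1 hX.2⟩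

omit [MeasurableSpace 𝕜] [BorelSpace 𝕜] in
theorem singularValueRatio_cfc_mem_Ioc {Y : Matrix (Fin 2) (Fin 2) 𝕜} (hY : Y.IsHermitian)
    (h1 : (1 - Y).PosDef) (h2 : (1 + Y).PosDef) :
    singularValueRatio (cfc (fun x : ℝ => √((1 - x) / (1 + x))) Y) ∈ Set.Ioc (0 : ℝ) 1 := by
  obtain ⟨U, hU, μ, hle, hYU, hf⟩ := exists_unitary_eq_diagonal_sorted hY
  have hm0 : ∀ i, 0 < 1 - μ i := by
    rw [← posDef_unitary_conj_diagonal (𝕜 := 𝕜) hU, ← smul_one_sub_unitary_conj hU, one_smul,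
      ← hYU]
    exact h1
  have hp0 : ∀ i, 0 < 1 + μ i := by
    rw [← posDef_unitary_conj_diagonal (𝕜 := 𝕜) hU, ← one_add_unitary_conj hU, ← hYU]
    exact h2
  have hpos : ∀ i, 0 < √((1 - μ i) / (1 + μ i)) := fun i =>
    Real.sqrt_pos.2 (div_pos (hm0 i) (hp0 i))
  have hll : √((1 - μ 0) / (1 + μ 0)) ≤ √((1 - μ 1) / (1 + μ 1)) := by
    refine Real.sqrt_le_sqrt ?_
    rw [div_le_div_iff₀ (hp0 0) (hp0 1)]
    nlinarith
  rw [hf, singularValueRatio_unitary_conj_diagonal hU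
    (z := fun i => √((1 - μ i) / (1 + μ i))) (hpos 0) hll]
  exact ⟨div_pos (hpos 0) (hpos 1), div_le_one_of_le₀ hll (hpos 1).le⟩

/-- The coordinates with $\|Y\|<1$ form a nonempty open subset: the eigenvalues of $Y$ then satisfy
$\mu_i^2<1$. -/
theorem volume_intervalCoords_ne_zero : volume (intervalCoords 𝕜) ≠ 0 := by
  have hc : Continuous fun y : ℝ × ℝ × 𝕜 => opNorm (herm y.1 y.2.1 y.2.2) :=
    continuous_opNorm.comp (continuous_herm (by fun_prop) (by fun_prop) (by fun_prop))
  have h0 : opNorm (herm 0 0 (0 : 𝕜)) < 1 := by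
    have : herm 0 0 (0 : 𝕜) = 0 := by
      ext i j
      fin_cases i <;> fin_cases j <;> simp [herm]
    simp [this, opNorm]
  refine (lt_of_lt_of_le ((isOpen_lt hc continuous_const).measure_pos volume
    ⟨0, h0⟩) (measure_mono ?_)).ne'
  intro y hy
  obtain ⟨U, hU, μ, hYU, -⟩ := exists_unitary_eq_diagonal (herm_isHermitian y.1 y.2.1 y.2.2)
  have hUU : Uᴴ * U = 1 := (Unitary.mem_iff.1 hU).1
  have hYY : herm y.1 y.2.1 y.2.2 * (herm y.1 y.2.1 y.2.2)ᴴ =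
      U * Matrix.diagonal (fun i => ((μ i * μ i : ℝ) : 𝕜)) * Uᴴ := by
    have hd : (fun i => ((μ i * μ i : ℝ) : 𝕜)) = fun i => (μ i : 𝕜) * (μ i : 𝕜) := by
      funext i
      rw [RCLike.ofReal_mul]
    rw [(herm_isHermitian y.1 y.2.1 y.2.2).eq, hYU, hd, ← Matrix.diagonal_mul_diagonal]
    calc _ = U * Matrix.diagonal (fun i => (μ i : 𝕜)) * (Uᴴ * U) *
          (Matrix.diagonal (fun i => (μ i : 𝕜)) * Uᴴ) := by simp only [mul_assoc]
      _ = _ := by rw [hUU]; simp only [mul_assoc, one_mul]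
  have hy' : ∀ i, 0 < 1 ^ 2 - μ i * μ i := by
    rw [← posDef_unitary_conj_diagonal (𝕜 := 𝕜) hU, ← smul_one_sub_unitary_conj hU, ← hYY]
    exact (opNorm_lt_iff one_pos).1 hy
  refine ⟨?_, ?_⟩
  · have := smul_one_sub_unitary_conj (𝕜 := 𝕜) hU μ 1
    rw [one_smul, ← hYU] at this
    rw [this, posDef_unitary_conj_diagonal hU]
    intro i
    nlinarith [hy' i]
  · rw [hYU, one_add_unitary_conj hU, posDef_unitary_conj_diagonal hU]
    intro i
    nlinarith [hy' i]

theorem operatorIntervalIntegral_eta : operatorIntervalIntegral 𝕜 (eta 𝕜) = ∞ := by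
  have h : ∀ y ∈ intervalCoords 𝕜, ENNReal.ofReal ((RCLike.re (1 - herm y.1 y.2.1 y.2.2 ^ 2).det) ^
      (((Module.finrank ℝ 𝕜 : ℝ) - 2) / 4)) * eta 𝕜 (singularValueRatio
        (cfc (fun x : ℝ => √((1 - x) / (1 + x))) (herm y.1 y.2.1 y.2.2))) = ∞ := by
    intro y hy
    have hσ := singularValueRatio_cfc_mem_Ioc (herm_isHermitian _ _ _) hy.1 hy.2
    rw [eta_eq_top hσ.1 hσ.2, ENNReal.mul_top]
    have h4 := RCLike.pos_iff.1 hy.1.det_pos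
    have h5 := RCLike.pos_iff.1 hy.2.det_pos
    have h3 : 1 - herm y.1 y.2.1 y.2.2 ^ 2 =
      (1 - herm y.1 y.2.1 y.2.2) * (1 + herm y.1 y.2.1 y.2.2) := by noncomm_ring
    have hq : 0 < RCLike.re (1 - herm y.1 y.2.1 y.2.2 ^ 2).det := by
      rw [h3, Matrix.det_mul, RCLike.mul_re, h4.2, zero_mul, sub_zero]
      exact mul_pos h4.1 h5.1
    exact (ENNReal.ofReal_pos.2 (Real.rpow_pos_of_pos hq _)).ne'
  rw [operatorIntervalIntegral]
  change ∫⁻ y in intervalCoords 𝕜, _ = ∞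
  rw [setLIntegral_congr_fun measurableSet_intervalCoords h]
  simp [volume_intervalCoords_ne_zero]

end Divergence

end QState

end

/-! ### The theorem. -/

theorem mainTheorem6 {𝕜 : Type*} [RCLike 𝕜] [MeasurableSpace 𝕜] [BorelSpace 𝕜]
    (d : ℕ) (hd : d = Module.finrank ℝ 𝕜) :
    ((∀ D ∈ QState.densityMatrices (Fin 2) 𝕜,
        QState.conditionedVolume Real.sqrt (QState.separableStates 𝕜) D =
          ENNReal.ofReal (4 * (RCLike.re D.det) ^ (5 / 2 * (d : ℝ) - (d : ℝ) ^ 2 / 2 - 1)) *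
            QState.operatorIntervalIntegral 𝕜 (QState.eta 𝕜)) ∧
      QState.stateVolume Real.sqrt (QState.separableStates 𝕜) =
        QState.baseIntegral
          (QState.conditionedVolume Real.sqrt (QState.separableStates 𝕜))) ∧
    ∀ r : ℝ, 0 < r → r ≤ 1 →
      (∀ D ∈ QState.densityMatrices (Fin 2) 𝕜,
        QState.conditionedVolume Real.sqrt (QState.separableStatesBelow 𝕜 r) D =
          ENNReal.ofReal (2 ^ d * (RCLike.re D.det) ^ (5 / 2 * (d : ℝ) - (d : ℝ) ^ 2 / 2 - 1)) *
            QState.operatorIntervalIntegral 𝕜 (QState.etaBelow 𝕜 r)) ∧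
      QState.stateVolume Real.sqrt (QState.separableStatesBelow 𝕜 r) =
        QState.baseIntegral
          (QState.conditionedVolume Real.sqrt (QState.separableStatesBelow 𝕜 r)) := by
  subst hd
  have hmain : ∀ r : ℝ, 0 < r → r ≤ 1 →
      (∀ D ∈ QState.densityMatrices (Fin 2) 𝕜,
        QState.conditionedVolume Real.sqrt (QState.separableStatesBelow 𝕜 r) D =
          ENNReal.ofReal (2 ^ Module.finrank ℝ 𝕜 * (RCLike.re D.det) ^
            (5 / 2 * (Module.finrank ℝ 𝕜 : ℝ) - (Module.finrank ℝ 𝕜 : ℝ) ^ 2 / 2 - 1)) *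
            QState.operatorIntervalIntegral 𝕜 (QState.etaBelow 𝕜 r)) ∧
      QState.stateVolume Real.sqrt (QState.separableStatesBelow 𝕜 r) =
        QState.baseIntegral
          (QState.conditionedVolume Real.sqrt (QState.separableStatesBelow 𝕜 r)) :=
    fun r hr hr1 => ⟨fun D hD => QState.conditionedVolume_separableStatesBelow hD hr hr1,
      QState.stateVolume_separableStatesBelow hr⟩
  refine ⟨?_, hmain⟩
  obtain ⟨h1, h2⟩ := hmain 1 one_pos le_rfl
  rw [QState.separableStatesBelow_one] at h1 h2
  refine ⟨fun D hD => ?_, h2⟩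
  have hdet : 0 < RCLike.re D.det := (RCLike.pos_iff.1 hD.1.det_pos).1
  -- At $r=1$ the general formula has $2^d$ where the claim has 4. As $\det D>0$, both prefactors
  -- are positive, and multiplied by the infinite integral both give $\infty$.
  have htop : QState.operatorIntervalIntegral 𝕜 (QState.etaBelow 𝕜 1) = ∞ :=
    QState.operatorIntervalIntegral_eta
  rw [h1 D hD, QState.operatorIntervalIntegral_eta, htop,
    ENNReal.mul_top (ENNReal.ofReal_pos.2 (by positivity)).ne',
    ENNReal.mul_top (ENNReal.ofReal_pos.2 (by positivity)).ne']
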